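/- Let $d \ge 2$ and let $m_l$ denote the $l$-dimensional Hausdorff measure. A non-empty Borel set $F \subseteq \mathbb{R}^n$ is called an $l$-set if there are constants $c, C > 0$ with $c\,r^l \le m_l(F \cap B(x,r)) \le C\,r^l$ for all $x \in F$ and $0 < r \le 1$. Let $\Omega \subseteq \mathbb{R}^d$ be a non-empty bounded domain (open and connected) and let $D \subseteq \partial\Omega$ be closed, such that: 1. every $x \in \overline{\partial\Omega \setminus D}$ has an open neighbourhood $U_x$ and a bi-Lipschitz map $\Phi_x$ from $U_x$ onto $(-1,1)^d$ with $\Phi_x(x) = 0$, $\Phi_x(\Omega \cap U_x) = (-1,1)^{d-1} \times (-1,0)$ and $\Phi_x(\partial\Omega \cap U_x) = (-1,1)^{d-1} \times \{0\}$; 2. $D$ is either empty or a $(d-1)$-set; 3. $\Omega$ is plump: there is $\kappa \in (0,1)$ such that for all $x \in \overline{\Omega}$ and $r \in (0, \operatorname{diam}\Omega)$ there is $y \in \overline{B(x,r)}$ with $\overline{B(y,\kappa r)} \subseteq \Omega$. All functions are complex valued. For $s \in (0,1)$ let $H^s(\mathbb{R}^d)$ be the space of all $g \in L^2(\mathbb{R}^d)$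 with $$\|g\|_{H^s(\mathbb{R}^d)} := \|g\|_{L^2(\mathbb{R}^d)} + \Big(\iint_{|x-y|<1} \frac{|g(x)-g(y)|^2}{|x-y|^{d+2s}}\,dx\,dy\Big)^{1/2} < \infty,$$ and let $H^s(\Omega) := \{g|_\Omega : g \in H^s(\mathbb{R}^d)\}$ with the quotient norm $\|f\|_{H^s(\Omega)} := \inf\{\|g\|_{H^s(\mathbb{R}^d)} : g \in H^s(\mathbb{R}^d),\ g|_\Omega = f\}$. For $s \in (\frac12,1)$ let $H^s_D(\Omega)$ be the set of restrictions to $\Omega$ of those $g \in H^s(\mathbb{R}^d)$ for which $\lim_{r\to0} \frac{1}{|B(x_0,r)|}\int_{B(x_0,r)} g(x)\,dx = 0$ for $m_{d-1}$-almost every $x_0 \in D$ (so $H^s_D(\Omega) = H^s(\Omega)$ if $D = \emptyset$). For an $l$-set $F \subseteq \mathbb{R}^n$ and $s \in (0,1)$ let $H^s(F, m_l)$ be the space of all $h \in L^2(F, m_l)$ with $$\|h\|_{H^s(F,m_l)} := \|h\|_{L^2(F,m_l)} + \Big(\iint_{x,y \in F,\ |x-y|<1} \frac{|h(x)-h(y)|^2}{|x-y|^{l+2s}}\,dm_l(x)\,dm_l(y)\Big)^{1/2}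 < \infty.$$ Put $\Omega{\uparrow}D := (\{0\} \times \Omega) \cup (\mathbb{R} \times D) \subseteq \mathbb{R}^{d+1}$, and for a function $f$ on $\Omega$ define $f_\uparrow$ on $\Omega{\uparrow}D$ by $f_\uparrow(0,x) = f(x)$ for $x \in \Omega$ and $f_\uparrow(t,x) = 0$ for $t \in \mathbb{R}$, $x \in D$. Then $\Omega{\uparrow}D$ is a $d$-set in $\mathbb{R}^{d+1}$, and: (i) for every $s \in (\frac12,1)$ there is a constant $C \ge 0$ (depending on $\Omega$, $D$, $s$, but not on $f$) such that every $f \in H^s_D(\Omega)$ satisfies $f_\uparrow \in H^s(\Omega{\uparrow}D, m_d)$ and $\|f_\uparrow\|_{H^s(\Omega\uparrow D,\, m_d)} \le C\,\|f\|_{H^s(\Omega)}$; (ii) for every $s \in (0,\frac12)$ there is a constant $C \ge 0$ (depending on $\Omega$, $D$, $s$, but not on $f$) such that every $f \in H^s(\Omega)$ satisfies $f_\uparrow \in H^s(\Omega{\uparrow}D, m_d)$ and $\|f_\uparrow\|_{H^s(\Omega\uparrow D,\, m_d)} \le C\,\|f\|_{H^s(\Omega)}$. -/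

import Mathlib

open MeasureTheory Set Filter Topology
open scoped NNReal ENNReal

namespace MixedBoundary

noncomputable section

/-- A non-empty Borel set `F ⊆ ℝⁿ` is an `l`-set if `m_l (F ∩ B(x,r)) ≃ r ^ l` for all `x ∈ F`
and `0 < r ≤ 1`, where `m_l` is the `l`-dimensional Hausdorff measure. -/
def IsLSet {n : ℕ} (l : ℝ) (F : Set (EuclideanSpace ℝ (Fin n))) : Prop :=
  F.Nonempty ∧ MeasurableSet F ∧
    ∃ c C : ℝ, 0 < c ∧ 0 < C ∧ ∀ x ∈ F, ∀ r : ℝ, 0 < r → r ≤ 1 →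
      ENNReal.ofReal (c * r ^ l) ≤ Measure.hausdorffMeasure l (F ∩ Metric.ball x r) ∧
      Measure.hausdorffMeasure l (F ∩ Metric.ball x r) ≤ ENNReal.ofReal (C * r ^ l)

/-- The open cube `(-1,1)^d`. -/
def cube (d : ℕ) : Set (EuclideanSpace ℝ (Fin d)) :=
  {y | ∀ i, y i ∈ Ioo (-1 : ℝ) 1}

/-- The lower half cube `(-1,1)^(d-1) × (-1,0)`; the last coordinate is the one whose index `i`
satisfies `i + 1 = d`. -/
def lowerHalfCube (d : ℕ) : Set (EuclideanSpace ℝ (Fin d)) :=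
  {y | y ∈ cube d ∧ ∀ i : Fin d, (i : ℕ) + 1 = d → y i < 0}

/-- The flat part `(-1,1)^(d-1) × {0}`. -/
def flatCube (d : ℕ) : Set (EuclideanSpace ℝ (Fin d)) :=
  {y | y ∈ cube d ∧ ∀ i : Fin d, (i : ℕ) + 1 = d → y i = 0}

/-- The geometric setting: a bounded domain `Ω ⊆ ℝᵈ`, `d ≥ 2`, with a Dirichlet part `D` of its
boundary. -/
structure IsAdmissible {d : ℕ} (Ω D : Set (EuclideanSpace ℝ (Fin d))) : Prop where
  two_le_dim : 2 ≤ d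
  isOpen : IsOpen Ω
  /-- connected, in particular non-empty -/
  isConnected : IsConnected Ω
  isBounded : Bornology.IsBounded Ω
  isClosed_dirichlet : IsClosed D
  dirichlet_subset : D ⊆ frontier Ω
  /-- bi-Lipschitz boundary charts around every point of `closure (∂Ω \ D)` -/
  exists_chart : ∀ x ∈ closure (frontier Ω \ D),
    ∃ (U : Set (EuclideanSpace ℝ (Fin d)))
      (Φ : EuclideanSpace ℝ (Fin d) → EuclideanSpace ℝ (Fin d)) (K : ℝ≥0),
      IsOpen U ∧ x ∈ U ∧
      LipschitzOnWith K Φ U ∧ AntilipschitzWith K (U.domRestrict Φ) ∧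
      Φ '' U = cube d ∧
      Φ x = 0 ∧
      Φ '' (Ω ∩ U) = lowerHalfCube d ∧
      Φ '' (frontier Ω ∩ U) = flatCube d
  /-- the Dirichlet part is empty or a `(d-1)`-set -/
  dirichlet_set : D = ∅ ∨ IsLSet ((d : ℝ) - 1) D
  /-- plumpness (interior corkscrew condition) -/
  plump : ∃ κ ∈ Ioo (0 : ℝ) 1, ∀ x ∈ closure Ω, ∀ r ∈ Ioo (0 : ℝ) (Metric.diam Ω),
    ∃ y ∈ Metric.closedBall x r, Metric.closedBall y (κ * r) ⊆ Ω

/-- The seminorm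
`(∬_{|x-y|<1} |f x - f y|² / |x-y|^(l+2s) dμ(y) dμ(x))^(1/2)`, with values in `[0,∞]`. -/
def seminorm {n : ℕ} (μ : Measure (EuclideanSpace ℝ (Fin n))) (l s : ℝ)
    (f : EuclideanSpace ℝ (Fin n) → ℂ) : ℝ≥0∞ :=
  (∫⁻ x, ∫⁻ y in Metric.ball x 1, ‖f x - f y‖ₑ ^ (2 : ℕ) / edist x y ^ (l + 2 * s) ∂μ ∂μ)
    ^ (1 / 2 : ℝ)

/-- The sum of the `L²(μ)`-norm and the seminorm above. -/
def fracNorm {n : ℕ} (μ : Measure (EuclideanSpace ℝ (Fin n))) (l s : ℝ)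
    (f : EuclideanSpace ℝ (Fin n) → ℂ) : ℝ≥0∞ :=
  eLpNorm f 2 μ + seminorm μ l s f

/-- `f ∈ L²(μ)` with finite norm `fracNorm μ l s f`. -/
def MemFrac {n : ℕ} (μ : Measure (EuclideanSpace ℝ (Fin n))) (l s : ℝ)
    (f : EuclideanSpace ℝ (Fin n) → ℂ) : Prop :=
  MemLp f 2 μ ∧ fracNorm μ l s f < ∞

/-- The norm of `H^s(ℝᵈ)` for `0 < s < 1`. -/
def hsNorm {d : ℕ} (s : ℝ) (g : EuclideanSpace ℝ (Fin d) → ℂ) : ℝ≥0∞ :=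
  fracNorm volume d s g

/-- Membership in `H^s(ℝᵈ)` for `0 < s < 1`. -/
def MemHs {d : ℕ} (s : ℝ) (g : EuclideanSpace ℝ (Fin d) → ℂ) : Prop :=
  MemFrac volume d s g

/-- Membership in `H^s_F(ℝᵈ)`: the trace `lim_{r → 0} ⨍_{B(x₀,r)} g` exists and vanishes for
`m_{d-1}`-almost every `x₀ ∈ F`. For `F = ∅` this is `H^s(ℝᵈ)`. -/
def MemHsVanishing {d : ℕ} (s : ℝ) (F : Set (EuclideanSpace ℝ (Fin d)))
    (g : EuclideanSpace ℝ (Fin d) → ℂ) : Prop :=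
  MemHs s g ∧
    ∀ᵐ x₀ ∂((Measure.hausdorffMeasure ((d : ℝ) - 1)).restrict F),
      Tendsto (fun r : ℝ => ⨍ x in Metric.ball x₀ r, g x ∂volume) (𝓝[>] 0) (𝓝 0)

/-- Membership of (the restriction to `Ω` of) `f` in `H^s(Ω) = {g|_Ω : g ∈ H^s(ℝᵈ)}`. -/
def MemHsOn {d : ℕ} (s : ℝ) (Ω : Set (EuclideanSpace ℝ (Fin d)))
    (f : EuclideanSpace ℝ (Fin d) → ℂ) : Prop :=
  ∃ g, MemHs s g ∧ g =ᵐ[volume.restrict Ω] f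

/-- Membership of (the restriction to `Ω` of) `f` in `H^s_F(Ω) = {g|_Ω : g ∈ H^s_F(ℝᵈ)}`. -/
def MemHsVanishingOn {d : ℕ} (s : ℝ) (Ω F : Set (EuclideanSpace ℝ (Fin d)))
    (f : EuclideanSpace ℝ (Fin d) → ℂ) : Prop :=
  ∃ g, MemHsVanishing s F g ∧ g =ᵐ[volume.restrict Ω] f

/-- The quotient norm of `H^s(Ω)`. -/
def hsNormOn {d : ℕ} (s : ℝ) (Ω : Set (EuclideanSpace ℝ (Fin d)))
    (f : EuclideanSpace ℝ (Fin d) → ℂ) : ℝ≥0∞ :=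
  ⨅ (g : EuclideanSpace ℝ (Fin d) → ℂ) (_ : MemHs s g ∧ g =ᵐ[volume.restrict Ω] f), hsNorm s g

/-- The norm of `H^s(F, m_l)` for an `l`-set `F` and `0 < s < 1`. -/
def lSetNorm {n : ℕ} (l s : ℝ) (F : Set (EuclideanSpace ℝ (Fin n)))
    (f : EuclideanSpace ℝ (Fin n) → ℂ) : ℝ≥0∞ :=
  fracNorm ((Measure.hausdorffMeasure l).restrict F) l s f

/-- Membership in `H^s(F, m_l)` for an `l`-set `F` and `0 < s < 1`. -/
def MemLSet {n : ℕ} (l s : ℝ) (F : Set (EuclideanSpace ℝ (Fin n)))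
    (f : EuclideanSpace ℝ (Fin n) → ℂ) : Prop :=
  MemFrac ((Measure.hausdorffMeasure l).restrict F) l s f

/-- The projection `ℝ^(d+1) = ℝ × ℝᵈ → ℝᵈ`, `(t, x) ↦ x`; the coordinate `t` of `z` is `z 0`. -/
def space {d : ℕ} (z : EuclideanSpace ℝ (Fin (d + 1))) : EuclideanSpace ℝ (Fin d) :=
  WithLp.toLp 2 (fun i => z i.succ)

/-- The infinite cylinder set `({0} × Ω) ∪ (ℝ × D) ⊆ ℝ^(d+1)`. -/
def cylinder {d : ℕ} (Ω D : Set (EuclideanSpace ℝ (Fin d))) :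
    Set (EuclideanSpace ℝ (Fin (d + 1))) :=
  {z | z 0 = 0 ∧ space z ∈ Ω} ∪ {z | space z ∈ D}

open Classical in
/-- The function that equals `f` on `{0} × Ω` and `0` elsewhere, in particular on `ℝ × D`
when `D` is disjoint from `Ω`. -/
def zeroExt {d : ℕ} (Ω : Set (EuclideanSpace ℝ (Fin d))) (f : EuclideanSpace ℝ (Fin d) → ℂ) :
    EuclideanSpace ℝ (Fin (d + 1)) → ℂ :=
  fun z => if z 0 = 0 ∧ space z ∈ Ω then f (space z) else 0

end

end MixedBoundary

/-!
The function `f_↑` vanishes on the wall `ℝ × D`, so its double integral over the cylinder splits into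
the interaction of the slice `{0} × Ω` with itself, which is at most a multiple of the energy of any
extension `g` of `f`, and twice the interaction of the slice with the wall. Because `m_d` on the wall
satisfies `m_d (B(z,r)) ≤ C r ^ d`, the potential `∫ |z - w| ^ (-(d+2s)) dm_d(w)` of the wall at a point
`z = (0, x)` is of order `dist(x, D) ^ (-2s)` near `D`. Everything thus reduces to Hardy's inequality
`∫ |g|² dist(x, D) ^ (-2s) ≤ C ‖g‖²` near `D`, here in the dyadic form `hardySum`
(`exists_lintegral_cylinder_le`).

For Hardy's inequality, let `m_k(x)` and `o_k(x)` be the quadratic mean and the quadratic oscillation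
of `g` over the ball of radius `2 ^ (-(k+1))` centred at `x ∈ D` (`meanSq`, `osc`). Lower regularity
of `D` bounds the mass of `g` in the `k`-th tube around `D` by `2⁻ᵏ ∫_D m_k²`
(`exists_setLIntegral_thickening_le`). Upper regularity of `D` and Tonelli's theorem bound
`∑ 2 ^ (k(2s-1)) ∫_D o_k²` by the energy of `g` (`exists_lintegral_tsum_osc_le`). Consecutive means
differ by at most a multiple of `o_k`, and the sum over scales is closed by a discrete Hardy
inequality: starting from the largest scale if `s < 1/2`, and from scale zero if `s > 1/2`, where the
means tend to zero by the boundary condition.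

The boundary condition concerns one extension `g₀` of `f`, while the quotient norm involves all of
them. Since `Ω` is plump, it occupies a fixed fraction of each small ball centred on `D`, so the
vanishing of the means passes from `g₀` to every other extension `g` of finite energy
(`ae_tendsto_meanSq`).

Regularity of the cylinder: on the slice, `m_d` is a multiple of the Lebesgue measure and plumpness
gives the lower bound; on the wall, the upper bound comes from coverings by products of balls with
intervals (`upperRegular_preimage_space`) and the lower bound from the mass distribution principle
applied to the product measure (`exists_map_consPoint_le_hausdorffMeasure`).
-/

namespace MixedBoundary

/-! ### Ahlfors regularity from above and packings -/

/-- `μ` is upper `l`-regular: `μ (B(x,r)) ≤ C r ^ l` for all centres `x`, not only for those in the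
support of `μ`, and for all radii. -/
def UpperRegular {X : Type*} [PseudoMetricSpace X] [MeasurableSpace X] (μ : Measure X) (l : ℝ) :
    Prop :=
  ∃ C : ℝ≥0, ∀ x : X, ∀ r : ℝ, 0 < r → μ (Metric.ball x r) ≤ C * ENNReal.ofReal r ^ l

/-- For a compact `l`-set the upper bound extends to centres off the set, by doubling the radius, and
to large radii, since the total measure is finite. -/
theorem IsLSet.upperRegular {n : ℕ} {l : ℝ} {D : Set (EuclideanSpace ℝ (Fin n))}
    (hl : 0 ≤ l) (hD : IsLSet l D) (hc : IsCompact D) :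
    IsFiniteMeasure ((Measure.hausdorffMeasure l).restrict D) ∧
      UpperRegular ((Measure.hausdorffMeasure l).restrict D) l := by
  obtain ⟨-, hDm, c, C, hc0, hC0, h⟩ := hD
  have hfin : (Measure.hausdorffMeasure l : Measure (EuclideanSpace ℝ (Fin n))) D < ∞ := by
    refine hc.measure_lt_top_of_nhdsWithin fun x hx => ?_
    refine ⟨D ∩ Metric.ball x 1, inter_mem_nhdsWithin _ (Metric.ball_mem_nhds x one_pos), ?_⟩
    exact (h x hx 1 one_pos le_rfl).2.trans_lt ENNReal.ofReal_lt_top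
  set H := (Measure.hausdorffMeasure l : Measure (EuclideanSpace ℝ (Fin n))) with hH
  refine ⟨⟨by simpa using hfin⟩, (C.toNNReal + (H D).toNNReal) * 2 ^ l, fun x r hr => ?_⟩
  have h2 : ENNReal.ofReal (2 * r) ^ l = 2 ^ l * ENNReal.ofReal r ^ l := by
    rw [ENNReal.ofReal_mul zero_le_two, ENNReal.mul_rpow_of_nonneg _ _ hl, ENNReal.ofReal_ofNat]
  have hgoal : (((C.toNNReal + (H D).toNNReal) * 2 ^ l : ℝ≥0) : ℝ≥0∞) * ENNReal.ofReal r ^ l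
      = ENNReal.ofReal C * ENNReal.ofReal (2 * r) ^ l + H D * ENNReal.ofReal (2 * r) ^ l := by
    rw [ENNReal.coe_mul, ENNReal.coe_add, ENNReal.coe_toNNReal hfin.ne,
      ENNReal.coe_rpow_of_nonneg _ hl, h2, add_mul, add_mul, mul_assoc, mul_assoc]
    rfl
  rw [hgoal, Measure.restrict_apply Metric.isOpen_ball.measurableSet, inter_comm]
  rcases (D ∩ Metric.ball x r).eq_empty_or_nonempty with he | ⟨p, hpD, hpx⟩
  · simp [he]
  by_cases hr2 : 2 * r ≤ 1
  · refine le_add_right ?_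
    calc H (D ∩ Metric.ball x r) ≤ H (D ∩ Metric.ball p (2 * r)) := by
          refine measure_mono (inter_subset_inter_right _ (Metric.ball_subset_ball' ?_))
          rw [Metric.mem_ball, dist_comm] at hpx
          linarith
      _ ≤ _ := by
          refine (h p hpD (2 * r) (by positivity) hr2).2.trans_eq ?_
          rw [ENNReal.ofReal_mul hC0.le, ENNReal.ofReal_rpow_of_pos (by positivity)]
  · refine le_add_left ((measure_mono inter_subset_left).trans ?_)
    have h1 : 1 ≤ ENNReal.ofReal (2 * r) := by rw [ENNReal.one_le_ofReal]; linarith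
    exact le_mul_of_one_le_right' (by simpa using ENNReal.rpow_le_rpow h1 hl)

theorem IsLSet.exists_le_restrict {n : ℕ} {l : ℝ} {D : Set (EuclideanSpace ℝ (Fin n))}
    (hD : IsLSet l D) :
    ∃ c : ℝ≥0, c ≠ 0 ∧ ∀ p ∈ D, ∀ r : ℝ, 0 < r → r ≤ 1 → c * ENNReal.ofReal r ^ l ≤
      (Measure.hausdorffMeasure l).restrict D (Metric.ball p r) := by
  obtain ⟨-, -, c, C, hc0, -, h⟩ := hD
  refine ⟨c.toNNReal, by simpa using hc0, fun p hp r hr hr1 => ?_⟩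
  rw [Measure.restrict_apply Metric.isOpen_ball.measurableSet, inter_comm]
  refine le_trans (le_of_eq ?_) (h p hp r hr hr1).1
  rw [ENNReal.ofReal_mul hc0.le, ENNReal.ofReal_rpow_of_pos hr]
  rfl

/-- Disjoint half-size balls around the points of a maximal separated set are counted by means of
the two regularity bounds. -/
theorem exists_finset_cover {X : Type*} [MetricSpace X] [MeasurableSpace X]
    [BorelSpace X] {m : Measure X} {l : ℝ} {D : Set X} {c C : ℝ≥0} (hc : c ≠ 0)
    (hlow : ∀ p ∈ D, ∀ r : ℝ, 0 < r → r ≤ 1 → c * ENNReal.ofReal r ^ l ≤ m (Metric.ball p r))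
    (hup : ∀ x, ∀ r : ℝ, 0 < r → m (Metric.ball x r) ≤ C * ENNReal.ofReal r ^ l)
    (x : X) {r ε : ℝ} (hε : 0 < ε) (hεr : ε ≤ r) (hε1 : ε ≤ 1) :
    ∃ T : Finset X, D ∩ Metric.ball x r ⊆ ⋃ p ∈ T, Metric.closedBall p ε ∧
      (T.card : ℝ≥0∞) * (c * ENNReal.ofReal (ε / 2) ^ l) ≤ C * ENNReal.ofReal (2 * r) ^ l := by
  set A := D ∩ Metric.ball x r with hA
  lift ε to ℝ≥0 using hε.le
  set a : ℝ≥0∞ := c * ENNReal.ofReal (ε / 2) ^ l with ha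
  set M : ℝ≥0∞ := C * ENNReal.ofReal (2 * r) ^ l with hM
  have hr : 0 < r := hε.trans_le hεr
  have hne : ∀ {t : ℝ}, 0 < t → ENNReal.ofReal t ^ l ≠ 0 ∧ ENNReal.ofReal t ^ l ≠ ∞ := by
    intro t ht
    rw [ENNReal.ofReal_rpow_of_pos ht]
    exact ⟨by simpa using Real.rpow_pos_of_pos ht l, ENNReal.ofReal_ne_top⟩
  have ha0 : a ≠ 0 := mul_ne_zero (by simpa using hc) (hne (by positivity)).1
  have haT : a ≠ ∞ := ENNReal.mul_ne_top ENNReal.coe_ne_top (hne (by positivity)).2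
  have hMT : M ≠ ∞ := ENNReal.mul_ne_top ENNReal.coe_ne_top (hne (by positivity)).2
  have key : ∀ P : Finset X, (P : Set X) ⊆ A → Metric.IsSeparated ε (P : Set X) →
      (P.card : ℝ≥0∞) * a ≤ M := by
    intro P hPA hP
    calc (P.card : ℝ≥0∞) * a = ∑ p ∈ P, a := by simp
      _ ≤ ∑ p ∈ P, m (Metric.ball p (ε / 2)) :=
          Finset.sum_le_sum fun p hp => hlow p (hPA hp).1 _ (by positivity) (by linarith)
      _ = m (⋃ p ∈ P, Metric.ball p (ε / 2)) := by
          refine (measure_biUnion_finset ?_ fun _ _ => Metric.isOpen_ball.measurableSet).symm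
          intro p hp q hq hpq
          refine Metric.ball_disjoint_ball ?_
          have : (ε : ℝ≥0∞) < edist p q := hP hp hq hpq
          rw [edist_nndist, ENNReal.coe_lt_coe, ← NNReal.coe_lt_coe, coe_nndist] at this
          linarith
      _ ≤ m (Metric.ball x (2 * r)) := by
          refine measure_mono (iUnion₂_subset fun p hp => Metric.ball_subset_ball' ?_)
          have := Metric.mem_ball.1 (hPA hp).2
          linarith
      _ ≤ M := hup x _ (by positivity)
  set N : ℕ := ⌊(M / a).toReal⌋₊ with hN
  have hpack : Metric.packingNumber ε A ≤ N := by
    refine iSup₂_le fun S hS => iSup_le fun hSs => ?_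
    by_contra! hlt
    obtain ⟨t, htS, ht⟩ := Set.exists_subset_encard_eq (Order.add_one_le_of_lt hlt)
    have htf : t.Finite := Set.finite_of_encard_eq_coe (k := N + 1) (by simpa using ht)
    lift t to Finset X using htf
    have hcard : t.card = N + 1 := by
      rw [Set.encard_coe_eq_coe_finsetCard] at ht
      exact_mod_cast ht
    have h1 := key t (htS.trans hS) (hSs.subset htS)
    rw [← ENNReal.le_div_iff_mul_le (Or.inl ha0) (Or.inl haT)] at h1
    have h2 : ((N + 1 : ℕ) : ℝ) ≤ (M / a).toReal := by
      rw [hcard] at h1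
      have h2 := ENNReal.toReal_mono (ENNReal.div_ne_top hMT ha0) h1
      rwa [ENNReal.toReal_natCast] at h2
    have h3 := Nat.lt_floor_add_one (M / a).toReal
    rw [← hN] at h3
    push_cast at h2
    linarith
  have hpT : Metric.packingNumber ε A ≠ ⊤ := ne_top_of_le_ne_top (ENat.natCast_ne_top N) hpack
  have hfin : (Metric.maximalSeparatedSet ε A).Finite := by
    refine Set.finite_of_encard_le_coe (k := N) ?_
    exact (Metric.IsSeparated.encard_le_packingNumber Metric.maximalSeparatedSet_subset
      Metric.isSeparated_maximalSeparatedSet).trans hpack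
  refine ⟨hfin.toFinset, ?_, key _ ?_ ?_⟩
  · intro y hy
    obtain ⟨p, hp, hyp⟩ := Metric.isCover_maximalSeparatedSet hpT hy
    simp only [mem_iUnion]
    refine ⟨p, by simpa using hp, ?_⟩
    have : edist y p ≤ ε := hyp
    rw [edist_nndist, ENNReal.coe_le_coe, ← NNReal.coe_le_coe, coe_nndist] at this
    exact this
  · simpa using Metric.maximalSeparatedSet_subset
  · simpa using Metric.isSeparated_maximalSeparatedSet

/-! ### The space `ℝ × ℝᵈ` -/

/-- The point `(t, x)` of `ℝ^(d+1) = ℝ × ℝᵈ`. -/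
def consPoint {d : ℕ} (t : ℝ) (x : EuclideanSpace ℝ (Fin d)) : EuclideanSpace ℝ (Fin (d + 1)) :=
  WithLp.toLp 2 (Fin.cons t x.ofLp)

variable {d : ℕ}

@[simp] theorem consPoint_zero (t : ℝ) (x : EuclideanSpace ℝ (Fin d)) : consPoint t x 0 = t := rfl

@[simp] theorem space_consPoint (t : ℝ) (x : EuclideanSpace ℝ (Fin d)) :
    space (consPoint t x) = x := rfl

theorem consPoint_space (z : EuclideanSpace ℝ (Fin (d + 1))) : consPoint (z 0) (space z) = z := by
  ext i
  refine Fin.cases rfl (fun i => rfl) i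

theorem dist_eq_sqrt (z w : EuclideanSpace ℝ (Fin (d + 1))) :
    dist z w = √((z 0 - w 0) ^ 2 + dist (space z) (space w) ^ 2) := by
  rw [EuclideanSpace.dist_eq, EuclideanSpace.dist_eq, Real.sq_sqrt (by positivity),
    Fin.sum_univ_succ, Real.dist_eq, sq_abs]
  rfl

theorem dist_space_le (z w : EuclideanSpace ℝ (Fin (d + 1))) :
    dist (space z) (space w) ≤ dist z w := by
  rw [dist_eq_sqrt z w]
  exact Real.le_sqrt_of_sq_le (by nlinarith [sq_nonneg (z 0 - w 0)])

theorem abs_sub_le_dist (z w : EuclideanSpace ℝ (Fin (d + 1))) : |z 0 - w 0| ≤ dist z w := by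
  rw [dist_eq_sqrt z w]
  refine Real.le_sqrt_of_sq_le ?_
  rw [sq_abs]
  nlinarith [sq_nonneg (dist (space z) (space w))]

theorem dist_le_abs_add_dist (z w : EuclideanSpace ℝ (Fin (d + 1))) :
    dist z w ≤ |z 0 - w 0| + dist (space z) (space w) := by
  rw [dist_eq_sqrt z w]
  refine Real.sqrt_le_iff.2 ⟨by positivity, ?_⟩
  have h : 0 ≤ |z 0 - w 0| * dist (space z) (space w) := by positivity
  nlinarith [sq_abs (z 0 - w 0)]

theorem continuous_space : Continuous (space (d := d)) := by
  unfold space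
  fun_prop

theorem isometry_consPoint : Isometry (consPoint (d := d) 0) :=
  Isometry.of_dist_eq fun x y => by
    rw [dist_eq_sqrt]
    simp

theorem continuous_consPoint :
    Continuous fun p : ℝ × EuclideanSpace ℝ (Fin d) => consPoint p.1 p.2 := by
  have : LipschitzWith 2 fun p : ℝ × EuclideanSpace ℝ (Fin d) => consPoint p.1 p.2 := by
    refine LipschitzWith.of_dist_le_mul fun p q => ?_
    refine (dist_le_abs_add_dist _ _).trans ?_
    have h1 : |p.1 - q.1| ≤ dist p q := by rw [← Real.dist_eq]; exact le_max_left _ _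
    have h2 : dist p.2 q.2 ≤ dist p q := le_max_right _ _
    simp only [consPoint_zero, space_consPoint, NNReal.coe_ofNat]
    linarith
  exact this.continuous

/-- A cylinder `ℝ × D` inherits upper regularity from `D`: a ball of radius `r` is covered by
about `(r/ε) ^ l · (r/ε)` products of `ε`-balls with intervals of length `ε`. -/
theorem upperRegular_preimage_space {l : ℝ} {D : Set (EuclideanSpace ℝ (Fin d))} (hl : 0 ≤ l)
    (hD : IsLSet l D) (hup : UpperRegular ((Measure.hausdorffMeasure l).restrict D) l) :
    UpperRegular ((Measure.hausdorffMeasure (l + 1)).restrict (space ⁻¹' D)) (l + 1) := by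
  obtain ⟨c, hcne, hlow⟩ := hD.exists_le_restrict
  obtain ⟨C, hC⟩ := hup
  have hc0 : (0 : ℝ) < c := by exact_mod_cast pos_iff_ne_zero.2 hcne
  refine ⟨C / c * 4 ^ l * (2 * 3 ^ (l + 1)), fun z r hr => ?_⟩
  rw [Measure.restrict_apply Metric.isOpen_ball.measurableSet]
  set ε : ℕ → ℝ := fun n => r / (n + 1) with hε
  have hε0 : ∀ n, 0 < ε n := fun n => by simp only [hε]; positivity
  have hεr : ∀ n, ε n ≤ r := fun n => div_le_self hr.le (by simp)
  have hεlim : Tendsto ε atTop (𝓝 0) := by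
    simpa [hε, div_eq_mul_inv] using (tendsto_one_div_add_atTop_nhds_zero_nat (𝕜 := ℝ)).const_mul r
  have hε1 : ∀ᶠ n in atTop, ε n ≤ 1 := hεlim.eventually_le_const one_pos
  have hT : ∀ n, ∃ T : Finset (EuclideanSpace ℝ (Fin d)), ε n ≤ 1 →
      D ∩ Metric.ball (space z) r ⊆ ⋃ p ∈ T, Metric.closedBall p (ε n) ∧
      (T.card : ℝ≥0∞) * (c * ENNReal.ofReal (ε n / 2) ^ l) ≤
        C * ENNReal.ofReal (2 * r) ^ l := by
    intro n
    by_cases hn : ε n ≤ 1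
    · obtain ⟨T, hT⟩ := exists_finset_cover hcne hlow hC (space z) (hε0 n) (hεr n) hn
      exact ⟨T, fun _ => hT⟩
    · exact ⟨∅, fun h => absurd h hn⟩
  choose T hT using hT
  -- the covering sets: products of `ε n`-balls with intervals of length `ε n`
  set t : ∀ n : ℕ, (T n) × Fin (2 * (n + 1)) → Set (EuclideanSpace ℝ (Fin (d + 1))) := fun n i =>
    {w | space w ∈ Metric.closedBall (i.1 : EuclideanSpace ℝ (Fin d)) (ε n) ∧
      w 0 ∈ Icc (z 0 - r + (i.2 : ℕ) * ε n) (z 0 - r + (i.2 : ℕ) * ε n + ε n)} with ht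
  have hdiam : ∀ n i, Metric.ediam (t n i) ≤ ENNReal.ofReal (3 * ε n) := by
    intro n i
    refine Metric.ediam_le fun w hw w' hw' => ?_
    rw [edist_dist]
    refine ENNReal.ofReal_le_ofReal ((dist_le_abs_add_dist w w').trans ?_)
    have h1 : |w 0 - w' 0| ≤ ε n := by
      rw [abs_sub_le_iff]
      constructor <;> linarith [hw.2.1, hw.2.2, hw'.2.1, hw'.2.2]
    have h2 := dist_triangle_right (space w) (space w') i.1
    have h3 := hw.1
    have h4 := hw'.1
    rw [Metric.mem_closedBall] at h3 h4
    linarith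
  have hcov : ∀ n, ε n ≤ 1 → Metric.ball z r ∩ space ⁻¹' D ⊆ ⋃ i, t n i := by
    rintro n hn w ⟨hw, hwD⟩
    have hws : space w ∈ D ∩ Metric.ball (space z) r :=
      ⟨hwD, (dist_space_le _ _).trans_lt hw⟩
    have h1 := (hT n hn).1 hws
    simp only [mem_iUnion] at h1 ⊢
    obtain ⟨p, hp, hwp⟩ := h1
    have h2 := abs_lt.1 ((abs_sub_le_dist w z).trans_lt hw)
    have h3 : 0 ≤ (w 0 - (z 0 - r)) / ε n := div_nonneg (by linarith) (hε0 n).le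
    have h4 : ⌊(w 0 - (z 0 - r)) / ε n⌋₊ < 2 * (n + 1) := by
      rw [Nat.floor_lt h3, div_lt_iff₀ (hε0 n)]
      have : ((2 * (n + 1) : ℕ) : ℝ) * ε n = 2 * r := by
        simp only [hε]; push_cast; field_simp
      rw [this]; linarith
    refine ⟨(⟨p, hp⟩, ⟨_, h4⟩), hwp, ?_, ?_⟩
    · have := Nat.floor_le h3
      rw [le_div_iff₀ (hε0 n)] at this
      show _ + (⌊(w 0 - (z 0 - r)) / ε n⌋₊ : ℝ) * ε n ≤ _
      linarith
    · have := Nat.lt_floor_add_one ((w 0 - (z 0 - r)) / ε n)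
      rw [div_lt_iff₀ (hε0 n)] at this
      show _ ≤ _ + (⌊(w 0 - (z 0 - r)) / ε n⌋₊ : ℝ) * ε n + ε n
      linarith
  have hsum : ∀ n, ε n ≤ 1 → ∑ i, Metric.ediam (t n i) ^ (l + 1) ≤
      ((C / c * 4 ^ l * (2 * 3 ^ (l + 1)) : ℝ≥0) : ℝ≥0∞) *
        ENNReal.ofReal r ^ (l + 1) := by
    intro n hn
    have hTn := (hT n hn).2
    have h1 : ∑ i, Metric.ediam (t n i) ^ (l + 1) ≤
        (T n).card * (2 * (n + 1)) * ENNReal.ofReal (3 * ε n) ^ (l + 1) := by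
      calc ∑ i, Metric.ediam (t n i) ^ (l + 1)
          ≤ ∑ _i : (T n) × Fin (2 * (n + 1)), ENNReal.ofReal (3 * ε n) ^ (l + 1) :=
            Finset.sum_le_sum fun i _ => ENNReal.rpow_le_rpow (hdiam n i) (by linarith)
        _ = _ := by simp
    refine h1.trans ?_
    have e1 : (T n).card * (2 * ((n : ℝ≥0∞) + 1)) * ENNReal.ofReal (3 * ε n) ^ (l + 1) =
        ENNReal.ofReal ((T n).card * (2 * (n + 1)) * (3 * ε n) ^ (l + 1)) := by
      have := hε0 n
      rw [ENNReal.ofReal_rpow_of_pos (by positivity), ENNReal.ofReal_mul (by positivity),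
        ENNReal.ofReal_mul (by positivity), ENNReal.ofReal_mul (by positivity), ENNReal.ofReal_add (by positivity) (by positivity)]
      simp
    have e2 : ((C / c * 4 ^ l * (2 * 3 ^ (l + 1)) : ℝ≥0) : ℝ≥0∞) *
        ENNReal.ofReal r ^ (l + 1) =
        ENNReal.ofReal (C / c * 4 ^ l * (2 * 3 ^ (l + 1)) * r ^ (l + 1)) := by
      rw [ENNReal.ofReal_mul (by positivity), ENNReal.ofReal_rpow_of_pos hr]
      congr 1
      rw [← ENNReal.ofReal_coe_nnreal]
      push_cast
      rfl
    rw [e1, e2]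
    refine ENNReal.ofReal_le_ofReal ?_
    have h2 : (T n).card * (c * (ε n / 2) ^ l) ≤ C * (2 * r) ^ l := by
      have e3 : ((T n).card : ℝ≥0∞) * (c * ENNReal.ofReal (ε n / 2) ^ l) =
          ENNReal.ofReal ((T n).card * (c * (ε n / 2) ^ l)) := by
        rw [ENNReal.ofReal_mul (by positivity), ENNReal.ofReal_mul hc0.le,
          ENNReal.ofReal_rpow_of_pos (by have := hε0 n; positivity)]
        simp [ENNReal.ofReal]
      have e4 : (C : ℝ≥0∞) * ENNReal.ofReal (2 * r) ^ l = ENNReal.ofReal (C * (2 * r) ^ l) := by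
        rw [ENNReal.ofReal_rpow_of_pos (by positivity), ENNReal.ofReal_mul (by positivity)]
        simp
      rw [e3, e4] at hTn
      exact (ENNReal.ofReal_le_ofReal_iff (by positivity)).1 hTn
    have hn0 : (0 : ℝ) < n + 1 := by positivity
    have h3 : ε n = r / (n + 1) := rfl
    have hε' := hε0 n
    have h4 : (2 * r) ^ l = 4 ^ l * (n + 1 : ℝ) ^ l * (ε n / 2) ^ l := by
      rw [← Real.mul_rpow (by positivity) (by positivity),
        ← Real.mul_rpow (by positivity) (by positivity), h3]
      congr 1
      field_simp
      norm_num
    have hpos : 0 < (ε n / 2) ^ l := Real.rpow_pos_of_pos (by positivity) l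
    have h5 : ((T n).card : ℝ) ≤ C / c * 4 ^ l * (n + 1 : ℝ) ^ l := by
      rw [h4] at h2
      have : ((T n).card * c) * (ε n / 2) ^ l ≤ (C * 4 ^ l * (n + 1 : ℝ) ^ l) * (ε n / 2) ^ l := by
        linarith
      have := le_of_mul_le_mul_right this hpos
      rw [div_mul_eq_mul_div, div_mul_eq_mul_div, le_div_iff₀ hc0]
      exact this
    have h6 : (3 * ε n) ^ (l + 1) * ((n + 1 : ℝ) ^ l * (n + 1)) = 3 ^ (l + 1) * r ^ (l + 1) := by
      have : (n + 1 : ℝ) ^ l * (n + 1) = (n + 1 : ℝ) ^ (l + 1) := by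
        rw [Real.rpow_add hn0, Real.rpow_one]
      rw [this, ← Real.mul_rpow (by positivity) (by positivity),
        ← Real.mul_rpow (by positivity) (by positivity), h3]
      congr 1
      field_simp
    calc (T n).card * (2 * ((n : ℝ) + 1)) * (3 * ε n) ^ (l + 1)
        ≤ (C / c * 4 ^ l * (n + 1 : ℝ) ^ l) * (2 * ((n : ℝ) + 1)) * (3 * ε n) ^ (l + 1) := by
          gcongr
      _ = C / c * 4 ^ l * 2 * ((3 * ε n) ^ (l + 1) * ((n + 1 : ℝ) ^ l * (n + 1))) := by ring
      _ = _ := by rw [h6]; ring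
  have hlim : Tendsto (fun n => ENNReal.ofReal (3 * ε n)) atTop (𝓝 0) := by
    have := ENNReal.tendsto_ofReal (hεlim.const_mul 3)
    simpa using this
  refine (Measure.hausdorffMeasure_le_liminf_sum (l + 1) _ _ hlim t
    (Eventually.of_forall hdiam) (hε1.mono hcov)).trans ?_
  exact liminf_le_of_le (by isBoundedDefault) fun b hb => by
    obtain ⟨n, hn, hn1⟩ := (hb.and hε1).exists
    exact hn.trans (hsum n hn1)

/-- The mass distribution principle for the product of the Lebesgue measure with an upper regular
measure. -/
theorem exists_map_consPoint_le_hausdorffMeasure {l : ℝ} (hl : 0 ≤ l)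
    {m : Measure (EuclideanSpace ℝ (Fin d))} [SFinite m] (hm : UpperRegular m l) :
    ∃ K : ℝ≥0, K ≠ 0 ∧ ∀ S : Set (EuclideanSpace ℝ (Fin (d + 1))),
      ((volume : Measure ℝ).prod m).map (fun p => consPoint p.1 p.2) S ≤
        K * Measure.hausdorffMeasure (l + 1) S := by
  obtain ⟨C, hC⟩ := hm
  set ν := ((volume : Measure ℝ).prod m).map (fun p => consPoint p.1 p.2) with hν
  obtain ⟨K, hK⟩ : ∃ K : ℝ≥0, K = (C + 1) * 2 ^ (l + 1) := ⟨_, rfl⟩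
  have hK0 : K ≠ 0 := by rw [hK]; positivity
  refine ⟨K, hK0, fun S => ?_⟩
  have key : (K⁻¹ : ℝ≥0∞) • ν ≤ Measure.hausdorffMeasure (l + 1) := by
    refine Measure.le_hausdorffMeasure (l + 1) _ 1 one_pos fun s hs => ?_
    rcases s.eq_empty_or_nonempty with rfl | ⟨p, hp⟩
    · simp
    set δ := (Metric.ediam s).toReal with hδ
    have hsT : Metric.ediam s ≠ ∞ := ne_top_of_le_ne_top ENNReal.one_ne_top hs
    have hsub : s ⊆ Metric.closedBall p δ := by
      intro w hw
      rw [Metric.mem_closedBall, dist_edist]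
      exact ENNReal.toReal_mono hsT (Metric.edist_le_ediam_of_mem hw hp)
    have hball : ν (Metric.closedBall p δ) ≤
        ENNReal.ofReal (2 * δ) * (C * ENNReal.ofReal (2 * δ) ^ l) := by
      rw [hν, Measure.map_apply continuous_consPoint.measurable
        Metric.isClosed_closedBall.measurableSet]
      calc _ ≤ ((volume : Measure ℝ).prod m)
              (Icc (p 0 - δ) (p 0 + δ) ×ˢ Metric.closedBall (space p) δ) := by
            refine measure_mono fun q (hq : dist (consPoint q.1 q.2) p ≤ δ) => ⟨?_, ?_⟩
            · have := abs_le.1 ((abs_sub_le_dist _ _).trans hq)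
              rw [consPoint_zero] at this
              constructor <;> linarith
            · have := (dist_space_le _ _).trans hq
              rwa [space_consPoint] at this
        _ = ENNReal.ofReal (2 * δ) * m (Metric.closedBall (space p) δ) := by
            rw [Measure.prod_prod, Real.volume_Icc]
            congr 2; ring
        _ ≤ _ := by
            rcases (ENNReal.toReal_nonneg : 0 ≤ δ).eq_or_lt with h0 | h0
            · rw [hδ, ← h0]; simp
            · gcongr
              refine (measure_mono ?_).trans (hC (space p) (2 * δ) (by positivity))
              exact Metric.closedBall_subset_ball (by linarith)
    calc (K⁻¹ : ℝ≥0∞) * ν s ≤ (K⁻¹ : ℝ≥0∞) * (K * Metric.ediam s ^ (l + 1)) := by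
          refine mul_le_mul' le_rfl (((measure_mono hsub).trans hball).trans ?_)
          have e1 : ENNReal.ofReal (2 * δ) = 2 * Metric.ediam s := by
            rw [ENNReal.ofReal_mul zero_le_two, ENNReal.ofReal_toReal hsT, ENNReal.ofReal_ofNat]
          have e2 : ENNReal.ofReal (2 * δ) * (C * ENNReal.ofReal (2 * δ) ^ l) =
              C * ENNReal.ofReal (2 * δ) ^ (l + 1) := by
            rw [ENNReal.rpow_add_of_nonneg _ _ hl zero_le_one, ENNReal.rpow_one]; ring
          rw [e2, e1, ENNReal.mul_rpow_of_nonneg _ _ (by linarith), hK, ENNReal.coe_mul,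
            ENNReal.coe_rpow_of_nonneg _ (by linarith), mul_assoc,
            ENNReal.coe_ofNat]
          exact mul_le_mul' (by simp) le_rfl
      _ = Metric.ediam s ^ (l + 1) := by
          rw [← mul_assoc, ENNReal.inv_mul_cancel (by simpa using hK0) ENNReal.coe_ne_top, one_mul]
  have h1 := key S
  rw [Measure.smul_apply, smul_eq_mul, ENNReal.inv_mul_le_iff (by simpa using hK0)
    ENNReal.coe_ne_top] at h1
  exact h1

/-! ### Regularity of the cylinder -/

theorem exists_hausdorffMeasure_eq_smul_volume (d : ℕ) :
    ∃ c : ℝ≥0, c ≠ 0 ∧ (Measure.hausdorffMeasure (d : ℝ) : Measure (EuclideanSpace ℝ (Fin d))) =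
      c • volume :=
  ⟨_, (Measure.addHaarScalarFactor_pos_of_isAddHaarMeasure _ volume).ne',
    Measure.isAddLeftInvariant_eq_smul _ volume⟩

theorem volume_ball_eq (x : EuclideanSpace ℝ (Fin d)) {r : ℝ} (hr : 0 < r) :
    volume (Metric.ball x r) = ENNReal.ofReal r ^ d *
      volume (Metric.ball (0 : EuclideanSpace ℝ (Fin d)) 1) := by
  rw [Measure.addHaar_ball_of_pos _ _ hr, ENNReal.ofReal_pow hr.le]
  simp

/-- The slice `{0} × Ω`. -/
def slice (Ω : Set (EuclideanSpace ℝ (Fin d))) : Set (EuclideanSpace ℝ (Fin (d + 1))) :=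
  {z | z 0 = 0 ∧ space z ∈ Ω}

theorem measurableSet_slice {Ω : Set (EuclideanSpace ℝ (Fin d))} (hΩ : MeasurableSet Ω) :
    MeasurableSet (slice Ω) :=
  ((isClosed_singleton (x := (0 : ℝ))).preimage
    (by fun_prop : Continuous fun z : EuclideanSpace ℝ (Fin (d + 1)) => z 0)).measurableSet.inter
    (continuous_space.measurable hΩ)

/-- The measure `m_d` on the slice `{0} × Ω` is a multiple of the Lebesgue measure on `Ω`. -/
theorem hausdorffMeasure_restrict_slice {c : ℝ≥0}
    (hc : (Measure.hausdorffMeasure (d : ℝ) : Measure (EuclideanSpace ℝ (Fin d))) = c • volume)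
    {Ω : Set (EuclideanSpace ℝ (Fin d))} (hΩ : MeasurableSet Ω) :
    (Measure.hausdorffMeasure (d : ℝ)).restrict (slice Ω) =
      c • (volume.restrict Ω).map (consPoint 0) := by
  have hSm := measurableSet_slice hΩ
  have hSr : slice Ω ⊆ range (consPoint (d := d) 0) := fun z hz =>
    ⟨space z, by rw [← hz.1, consPoint_space]⟩
  have hpre : consPoint 0 ⁻¹' slice Ω = Ω := by ext x; simp [slice]
  have h := (isometry_consPoint (d := d)).map_hausdorffMeasure (d := d) (Or.inl (by positivity))
  have h' := congrArg (fun μ : Measure _ => μ.restrict (slice Ω)) h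
  simp only at h'
  rw [Measure.restrict_restrict hSm, inter_eq_self_of_subset_left hSr,
    Measure.restrict_map isometry_consPoint.continuous.measurable hSm, hpre, hc,
    Measure.restrict_smul, Measure.map_smul] at h'
  exact h'.symm

theorem upperRegular_slice {Ω : Set (EuclideanSpace ℝ (Fin d))} (hΩ : MeasurableSet Ω) :
    UpperRegular ((Measure.hausdorffMeasure (d : ℝ)).restrict (slice Ω)) d := by
  obtain ⟨c, -, hc⟩ := exists_hausdorffMeasure_eq_smul_volume d
  refine ⟨c * (volume (Metric.ball (0 : EuclideanSpace ℝ (Fin d)) 1)).toNNReal,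
    fun z r hr => ?_⟩
  rw [hausdorffMeasure_restrict_slice hc hΩ, Measure.smul_apply,
    Measure.map_apply isometry_consPoint.continuous.measurable Metric.isOpen_ball.measurableSet,
    ENNReal.coe_mul, ENNReal.coe_toNNReal measure_ball_lt_top.ne, mul_assoc, ENNReal.smul_def,
    smul_eq_mul]
  refine mul_le_mul' le_rfl ((Measure.restrict_apply_le _ _).trans ?_)
  rw [mul_comm, ENNReal.rpow_natCast, ← volume_ball_eq (space z) hr]
  refine measure_mono fun x (hx : dist (consPoint 0 x) z < r) => ?_
  have := (dist_space_le _ _).trans_lt hx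
  rwa [space_consPoint] at this

/-- Plumpness gives measure density of `Ω` at all points of its closure. -/
theorem IsAdmissible.exists_le_volume {Ω D : Set (EuclideanSpace ℝ (Fin d))}
    (h : IsAdmissible Ω D) :
    ∃ c : ℝ≥0, c ≠ 0 ∧ ∀ x ∈ closure Ω, ∀ r : ℝ, 0 < r → r ≤ 1 →
      c * ENNReal.ofReal r ^ d ≤ volume (Ω ∩ Metric.ball x r) := by
  obtain ⟨κ, ⟨hκ0, hκ1⟩, hκ⟩ := h.plump
  have : Nonempty (Fin d) := ⟨⟨0, by have := h.two_le_dim; omega⟩⟩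
  have hdiam : 0 < Metric.diam Ω := by
    refine Metric.diam_pos ?_ h.isBounded
    rw [← Set.not_subsingleton_iff]
    intro hs
    exact (h.isOpen.measure_pos volume h.isConnected.nonempty).ne' (hs.measure_zero volume)
  set θ := min (1 / 2) (Metric.diam Ω / 2) with hθ
  have hθ0 : 0 < θ := lt_min (by norm_num) (by linarith)
  set V := volume (Metric.ball (0 : EuclideanSpace ℝ (Fin d)) 1) with hV
  have hVT : V ≠ ∞ := measure_ball_lt_top.ne
  have hV0 : V ≠ 0 := (Metric.measure_ball_pos volume _ one_pos).ne'
  refine ⟨(κ * θ).toNNReal ^ d * V.toNNReal, ?_, fun x hx r hr hr1 => ?_⟩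
  · refine mul_ne_zero (pow_ne_zero _ ?_) (by simp [ENNReal.toNNReal_eq_zero_iff, hV0, hVT])
    simpa using mul_pos hκ0 hθ0
  have h1 : θ * r < Metric.diam Ω := by
    have := min_le_right (1 / 2) (Metric.diam Ω / 2)
    nlinarith
  have h2 : θ * r ≤ r / 2 := by
    have := min_le_left (1 / 2) (Metric.diam Ω / 2)
    nlinarith
  obtain ⟨y, hy, hyΩ⟩ := hκ x hx (θ * r) ⟨by positivity, h1⟩
  calc _ = volume (Metric.ball y (κ * (θ * r))) := by
        rw [volume_ball_eq _ (by positivity), ← mul_assoc, ENNReal.ofReal_mul (by positivity),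
          ENNReal.coe_mul, ENNReal.coe_toNNReal hVT, mul_pow, ENNReal.coe_pow]
        simp only [ENNReal.ofReal, hV]
        ring
    _ ≤ _ := by
        refine measure_mono (subset_inter (Metric.ball_subset_closedBall.trans hyΩ)
          (Metric.ball_subset_ball' ?_))
        have := Metric.mem_closedBall.1 hy
        nlinarith [mul_pos hθ0 hr]

theorem IsAdmissible.dim_sub_one_nonneg {Ω D : Set (EuclideanSpace ℝ (Fin d))}
    (h : IsAdmissible Ω D) : (0 : ℝ) ≤ (d : ℝ) - 1 := by
  have : (2 : ℝ) ≤ d := by exact_mod_cast h.two_le_dim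
  linarith

theorem IsAdmissible.isCompact_dirichlet {Ω D : Set (EuclideanSpace ℝ (Fin d))}
    (h : IsAdmissible Ω D) : IsCompact D :=
  Metric.isCompact_of_isClosed_isBounded h.isClosed_dirichlet
    (h.isBounded.closure.subset (h.dirichlet_subset.trans frontier_subset_closure))

/-- For every admissible pair the cylinder `ℝ × D` is upper `d`-regular. -/
theorem IsAdmissible.upperRegular_wall {Ω D : Set (EuclideanSpace ℝ (Fin d))}
    (h : IsAdmissible Ω D) :
    UpperRegular ((Measure.hausdorffMeasure (d : ℝ)).restrict (space ⁻¹' D)) d := by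
  rcases h.dirichlet_set with rfl | hD
  · exact ⟨0, fun x r _ => by simp⟩
  · have hd := h.dim_sub_one_nonneg
    have := upperRegular_preimage_space hd hD (hD.upperRegular hd h.isCompact_dirichlet).2
    rwa [sub_add_cancel] at this

/-- Lower regularity of the wall `ℝ × D` at its points. -/
theorem exists_le_hausdorffMeasure_wall {l : ℝ} {D : Set (EuclideanSpace ℝ (Fin d))} (hl : 0 ≤ l)
    (hD : IsLSet l D) (hcpt : IsCompact D) :
    ∃ c : ℝ≥0, c ≠ 0 ∧ ∀ z : EuclideanSpace ℝ (Fin (d + 1)), space z ∈ D → ∀ r : ℝ, 0 < r → r ≤ 1 →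
      c * ENNReal.ofReal r ^ (l + 1) ≤
        Measure.hausdorffMeasure (l + 1) (space ⁻¹' D ∩ Metric.ball z r) := by
  obtain ⟨hfin, hup⟩ := hD.upperRegular hl hcpt
  obtain ⟨K, hK0, hK⟩ := exists_map_consPoint_le_hausdorffMeasure hl hup
  obtain ⟨-, hDm, c, C₀, hc0, -, h⟩ := hD
  refine ⟨K⁻¹ * (c.toNNReal * 2⁻¹ ^ l), ?_, fun z hz r hr hr1 => ?_⟩
  · have : 0 < c.toNNReal := by simpa using hc0
    positivity
  refine le_trans ?_ (ENNReal.inv_mul_le_iff (by simpa using hK0) ENNReal.coe_ne_top |>.2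
    (hK (space ⁻¹' D ∩ Metric.ball z r)))
  rw [ENNReal.coe_mul, ENNReal.coe_inv hK0, mul_assoc]
  refine mul_le_mul' le_rfl ?_
  rw [Measure.map_apply continuous_consPoint.measurable
    ((continuous_space.measurable hDm).inter Metric.isOpen_ball.measurableSet)]
  calc _ = ENNReal.ofReal r * ENNReal.ofReal (c * (r / 2) ^ l) := by
        have e : ENNReal.ofReal (r / 2) = ENNReal.ofReal r * 2⁻¹ := by
          rw [div_eq_mul_inv, ENNReal.ofReal_mul hr.le, ENNReal.ofReal_inv_of_pos two_pos]
          simp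
        rw [ENNReal.ofReal_mul hc0.le, ← ENNReal.ofReal_rpow_of_pos (by positivity), e,
          ENNReal.mul_rpow_of_nonneg _ _ hl, ENNReal.rpow_add_of_nonneg _ _ hl zero_le_one,
          ENNReal.rpow_one, ENNReal.coe_mul, ENNReal.coe_rpow_of_nonneg _ hl,
          ENNReal.coe_inv two_ne_zero, ENNReal.coe_ofNat]
        simp only [ENNReal.ofReal]
        ring
    _ ≤ (volume (Ioo (z 0 - r / 2) (z 0 + r / 2))) *
          (Measure.hausdorffMeasure l).restrict D (D ∩ Metric.ball (space z) (r / 2)) := by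
        rw [Real.volume_Ioo, Measure.restrict_apply (hDm.inter Metric.isOpen_ball.measurableSet),
          inter_eq_self_of_subset_left inter_subset_left]
        refine mul_le_mul' (le_of_eq ?_) (h _ hz _ (by positivity) (by linarith)).1
        congr 1; ring
    _ = _ := (Measure.prod_prod _ _).symm
    _ ≤ _ := by
        refine measure_mono fun q hq => ⟨?_, ?_⟩
        · exact hq.2.1
        · have h1 : |q.1 - z 0| < r / 2 := by
            rw [abs_lt]; constructor <;> linarith [hq.1.1, hq.1.2]
          have h2 : dist q.2 (space z) < r / 2 := hq.2.2
          refine (dist_le_abs_add_dist _ _).trans_lt ?_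
          rw [consPoint_zero, space_consPoint]
          linarith

theorem IsAdmissible.isLSet_cylinder {Ω D : Set (EuclideanSpace ℝ (Fin d))}
    (h : IsAdmissible Ω D) : IsLSet (d : ℝ) (cylinder Ω D) := by
  have hΩm := h.isOpen.measurableSet
  have hd := h.dim_sub_one_nonneg
  have hWm : MeasurableSet {z : EuclideanSpace ℝ (Fin (d + 1)) | space z ∈ D} :=
    continuous_space.measurable h.isClosed_dirichlet.measurableSet
  obtain ⟨c, hc0, hc⟩ := exists_hausdorffMeasure_eq_smul_volume d
  obtain ⟨c₁, hc₁, h₁⟩ := h.exists_le_volume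
  obtain ⟨c₂, hc₂, h₂⟩ : ∃ c : ℝ≥0, c ≠ 0 ∧ ∀ z : EuclideanSpace ℝ (Fin (d + 1)), space z ∈ D →
      ∀ r : ℝ, 0 < r → r ≤ 1 → c * ENNReal.ofReal r ^ (d : ℝ) ≤
        Measure.hausdorffMeasure (d : ℝ) (space ⁻¹' D ∩ Metric.ball z r) := by
    rcases h.dirichlet_set with rfl | hD
    · exact ⟨1, one_ne_zero, fun z hz => absurd hz (notMem_empty _)⟩
    · have := exists_le_hausdorffMeasure_wall hd hD h.isCompact_dirichlet
      rwa [sub_add_cancel] at this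
  obtain ⟨C₁, hC₁⟩ := upperRegular_slice hΩm
  obtain ⟨C₂, hC₂⟩ := h.upperRegular_wall
  refine ⟨?_, (measurableSet_slice hΩm).union hWm, ((min (c * c₁) c₂ : ℝ≥0) : ℝ), C₁ + C₂ + 1, ?_, by positivity,
    fun z hz r hr hr1 => ?_⟩
  · obtain ⟨x, hx⟩ := h.isConnected.nonempty
    exact ⟨consPoint 0 x, Or.inl ⟨rfl, hx⟩⟩
  · exact_mod_cast lt_min (mul_pos (pos_iff_ne_zero.2 hc0) (pos_iff_ne_zero.2 hc₁))
      (pos_iff_ne_zero.2 hc₂)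
  constructor
  · rw [ENNReal.ofReal_mul (NNReal.coe_nonneg _), ← ENNReal.ofReal_rpow_of_pos hr,
      ENNReal.ofReal_coe_nnreal]
    rcases hz with hz | hz
    · calc _ ≤ (c : ℝ≥0∞) * (c₁ * ENNReal.ofReal r ^ d) := by
            rw [ENNReal.rpow_natCast, ← mul_assoc, ← ENNReal.coe_mul]
            exact mul_le_mul' (ENNReal.coe_le_coe.2 (min_le_left _ _)) le_rfl
        _ ≤ c * volume (Ω ∩ Metric.ball (space z) r) :=
            mul_le_mul' le_rfl (h₁ _ (subset_closure hz.2) r hr hr1)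
        _ = Measure.hausdorffMeasure (d : ℝ) (Ω ∩ Metric.ball (space z) r) := by
            rw [hc]; rfl
        _ = Measure.hausdorffMeasure (d : ℝ) (consPoint 0 '' (Ω ∩ Metric.ball (space z) r)) :=
            (isometry_consPoint.hausdorffMeasure_image (Or.inl (by positivity)) _).symm
        _ ≤ _ := by
            refine measure_mono ?_
            rintro _ ⟨x, ⟨hxΩ, hxr⟩, rfl⟩
            refine ⟨Or.inl ⟨rfl, hxΩ⟩, (dist_le_abs_add_dist _ _).trans_lt ?_⟩
            rw [hz.1]
            simpa using hxr
    · refine le_trans (mul_le_mul' (ENNReal.coe_le_coe.2 (min_le_right _ _)) le_rfl) ?_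
      exact (h₂ z hz r hr hr1).trans (measure_mono (inter_subset_inter_left _ subset_union_right))
  · rw [cylinder, union_inter_distrib_right]
    refine (measure_union_le _ _).trans ?_
    have e1 := hC₁ z r hr
    have e2 := hC₂ z r hr
    rw [Measure.restrict_apply Metric.isOpen_ball.measurableSet, inter_comm] at e1 e2
    refine (add_le_add e1 e2).trans ?_
    rw [← add_mul, ENNReal.ofReal_mul (by positivity), ← ENNReal.ofReal_rpow_of_pos hr]
    refine mul_le_mul' ?_ le_rfl
    rw [ENNReal.ofReal_add (by positivity) (by positivity), ENNReal.ofReal_add (by positivity)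
      (by positivity)]
    simp

/-! ### Sums with geometric weights -/

theorem two_rpow_add (a b : ℝ) : (2 : ℝ≥0∞) ^ (a + b) = 2 ^ a * 2 ^ b :=
  ENNReal.rpow_add _ _ two_ne_zero ENNReal.ofNat_ne_top

theorem two_rpow_ne_zero (a : ℝ) : (2 : ℝ≥0∞) ^ a ≠ 0 := by simp [ENNReal.rpow_eq_zero_iff]

theorem two_rpow_ne_top (a : ℝ) : (2 : ℝ≥0∞) ^ a ≠ ∞ := by simp [ENNReal.rpow_eq_top_iff]

theorem two_rpow_lt_one {a : ℝ} (ha : a < 0) : (2 : ℝ≥0∞) ^ a < 1 :=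
  ENNReal.rpow_lt_one_of_one_lt_of_neg ENNReal.one_lt_two ha

theorem two_rpow_le_two_rpow {a b : ℝ} (h : a ≤ b) : (2 : ℝ≥0∞) ^ a ≤ 2 ^ b :=
  ENNReal.rpow_le_rpow_of_exponent_le ENNReal.one_lt_two.le h

theorem exists_tsum_two_rpow_eq {σ : ℝ} (hσ : 0 < σ) :
    ∃ K : ℝ≥0, ∑' j : ℕ, (2 : ℝ≥0∞) ^ (-(j * σ)) = K := by
  have h : ∀ j : ℕ, (2 : ℝ≥0∞) ^ (-(j * σ)) = (2 ^ (-σ)) ^ j := fun j => by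
    rw [← ENNReal.rpow_natCast, ← ENNReal.rpow_mul]; ring_nf
  simp_rw [h, ENNReal.tsum_geometric]
  refine ⟨(1 - (2 : ℝ≥0∞) ^ (-σ))⁻¹.toNNReal, (ENNReal.coe_toNNReal ?_).symm⟩
  exact ENNReal.inv_ne_top.2 (tsub_pos_iff_lt.2 (two_rpow_lt_one (by linarith))).ne'

/-- If `0 ≤ θ < 1`, some constant `K` absorbs both `1` and `θ K`. -/
theorem exists_one_add_mul_le {θ : ℝ≥0∞} (hθ : θ < 1) : ∃ K : ℝ≥0, 1 + θ * K ≤ (K : ℝ≥0∞) := by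
  have h0 : (1 - θ) ≠ 0 := (tsub_pos_iff_lt.2 hθ).ne'
  refine ⟨(1 - θ)⁻¹.toNNReal, ?_⟩
  rw [ENNReal.coe_toNNReal (ENNReal.inv_ne_top.2 h0)]
  have h1 : (1 - θ) * (1 - θ)⁻¹ = 1 :=
    ENNReal.mul_inv_cancel h0 (ne_top_of_le_ne_top ENNReal.one_ne_top tsub_le_self)
  calc 1 + θ * (1 - θ)⁻¹ = (1 - θ + θ) * (1 - θ)⁻¹ := by rw [add_mul, h1]
    _ ≤ _ := by rw [tsub_add_cancel_of_le hθ.le, one_mul]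

/-- Summing the weights `2 ^ (j a)` over the dyadic scales `2⁻ʲ > t` gives the power `t ^ (-a)`. -/
theorem exists_tsum_ite_le {a : ℝ} (ha : 0 < a) : ∃ K : ℝ≥0, ∀ t : ℝ≥0∞,
    ∑' j : ℕ, (if t < 2 ^ (-(j : ℝ)) then (2 : ℝ≥0∞) ^ (j * a) else 0) ≤ K * (t ^ a)⁻¹ := by
  obtain ⟨K, hK⟩ := exists_one_add_mul_le (two_rpow_lt_one (a := -a) (by linarith))
  have hsum : ∀ n : ℕ, ∑ j ∈ Finset.range (n + 1), (2 : ℝ≥0∞) ^ (j * a) ≤ K * 2 ^ (n * a) := by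
    intro n
    induction n with
    | zero => simpa using (le_self_add).trans hK
    | succ n ih =>
      rw [Finset.sum_range_succ]
      calc _ ≤ K * (2 : ℝ≥0∞) ^ (n * a) + 2 ^ (((n + 1 : ℕ) : ℝ) * a) := by gcongr
        _ = (1 + 2 ^ (-a) * K) * 2 ^ (((n + 1 : ℕ) : ℝ) * a) := by
          have : (2 : ℝ≥0∞) ^ (n * a) = 2 ^ (-a) * 2 ^ (((n + 1 : ℕ) : ℝ) * a) := by
            rw [← two_rpow_add]; push_cast; ring_nf
          rw [this]; ring
        _ ≤ _ := by gcongr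
  refine ⟨K, fun t => ?_⟩
  rw [ENNReal.tsum_eq_iSup_nat]
  refine iSup_le fun n => ?_
  induction n with
  | zero => simp
  | succ n ih =>
    by_cases h : t < 2 ^ (-(n : ℝ))
    · calc _ ≤ ∑ j ∈ Finset.range (n + 1), (2 : ℝ≥0∞) ^ (j * a) :=
            Finset.sum_le_sum fun j _ => by split_ifs <;> simp
        _ ≤ K * 2 ^ (n * a) := hsum n
        _ ≤ _ := by
          gcongr
          rw [← ENNReal.inv_le_inv, inv_inv, ← ENNReal.rpow_neg]
          refine (ENNReal.rpow_le_rpow h.le ha.le).trans_eq ?_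
          rw [← ENNReal.rpow_mul]; ring_nf
    · rw [Finset.sum_range_succ, if_neg h, add_zero]
      exact ih

theorem sq_tsum_mul_le (f g : ℕ → ℝ≥0∞) :
    (∑' j, f j * g j) ^ 2 ≤ (∑' j, f j ^ 2) * ∑' j, g j ^ 2 := by
  have h := ENNReal.lintegral_mul_le_Lp_mul_Lq Measure.count Real.HolderConjugate.two_two
    (measurable_from_nat (f := f)).aemeasurable (measurable_from_nat (f := g)).aemeasurable
  simp only [lintegral_count, Pi.mul_apply, ENNReal.rpow_two] at h
  refine (pow_le_pow_left' h 2).trans_eq ?_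
  have : ∀ x : ℝ≥0∞, (x ^ (1 / 2 : ℝ)) ^ 2 = x := fun x => by
    rw [← ENNReal.rpow_two, ← ENNReal.rpow_mul]; simp
  rw [mul_pow, this, this]

/-- Discrete Hardy inequality for tails. -/
theorem exists_tsum_sq_tail_le {τ : ℝ} (hτ : 0 < τ) : ∃ K : ℝ≥0, ∀ o : ℕ → ℝ≥0∞,
    ∑' k : ℕ, (2 : ℝ≥0∞) ^ (k * τ) * (∑' j, o (k + j)) ^ 2 ≤
      K * ∑' k : ℕ, (2 : ℝ≥0∞) ^ (k * τ) * o k ^ 2 := by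
  obtain ⟨K, hK⟩ := exists_tsum_two_rpow_eq (half_pos hτ)
  refine ⟨K * K, fun o => ?_⟩
  have h1 : ∀ k : ℕ, (∑' j, o (k + j)) ^ 2 ≤
      K * ∑' j : ℕ, (2 : ℝ≥0∞) ^ (j * (τ / 2)) * o (k + j) ^ 2 := by
    intro k
    have h := sq_tsum_mul_le (fun j : ℕ => (2 : ℝ≥0∞) ^ (-(j * (τ / 2)) / 2))
      (fun j : ℕ => (2 : ℝ≥0∞) ^ (j * (τ / 2) / 2) * o (k + j))
    have e1 : ∀ j : ℕ, (2 : ℝ≥0∞) ^ (-(j * (τ / 2)) / 2) *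
        ((2 : ℝ≥0∞) ^ (j * (τ / 2) / 2) * o (k + j)) = o (k + j) := fun j => by
      rw [← mul_assoc, ← two_rpow_add, neg_div, neg_add_cancel, ENNReal.rpow_zero, one_mul]
    have e2 : ∀ x : ℝ, ((2 : ℝ≥0∞) ^ (x / 2)) ^ 2 = 2 ^ x := fun x => by
      rw [← ENNReal.rpow_two, ← ENNReal.rpow_mul]; congr 1; ring
    simp only [e1, mul_pow, e2] at h
    rwa [hK] at h
  calc _ ≤ ∑' k : ℕ, (2 : ℝ≥0∞) ^ (k * τ) *
        (K * ∑' j : ℕ, (2 : ℝ≥0∞) ^ (j * (τ / 2)) * o (k + j) ^ 2) := by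
        gcongr with k
        exact h1 k
    _ = K * ∑' k : ℕ, ∑' j : ℕ, (2 : ℝ≥0∞) ^ (-(j * (τ / 2))) *
        (2 ^ (((k + j : ℕ) : ℝ) * τ) * o (k + j) ^ 2) := by
        rw [← ENNReal.tsum_mul_left]
        congr 1 with k
        rw [← ENNReal.tsum_mul_left, ← ENNReal.tsum_mul_left, ← ENNReal.tsum_mul_left]
        congr 1 with j
        have : (2 : ℝ≥0∞) ^ (-(j * (τ / 2))) * 2 ^ (((k + j : ℕ) : ℝ) * τ) =
            2 ^ (k * τ) * 2 ^ (j * (τ / 2)) := by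
          rw [← two_rpow_add, ← two_rpow_add]; push_cast; ring_nf
        calc _ = K * (2 ^ (k * τ) * 2 ^ (j * (τ / 2))) * o (k + j) ^ 2 := by ring
          _ = _ := by rw [← this]; ring
    _ = K * ∑' j : ℕ, ∑' k : ℕ, (2 : ℝ≥0∞) ^ (-(j * (τ / 2))) *
        (2 ^ (((k + j : ℕ) : ℝ) * τ) * o (k + j) ^ 2) := by rw [ENNReal.tsum_comm]
    _ ≤ K * ∑' j : ℕ, (2 : ℝ≥0∞) ^ (-(j * (τ / 2))) *
        ∑' k : ℕ, (2 : ℝ≥0∞) ^ (k * τ) * o k ^ 2 := by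
        gcongr with j
        rw [ENNReal.tsum_mul_left]
        refine mul_le_mul' le_rfl ?_
        exact ENNReal.tsum_comp_le_tsum_of_injective (add_left_injective j)
          (fun k : ℕ => (2 : ℝ≥0∞) ^ (k * τ) * o k ^ 2)
    _ = _ := by rw [ENNReal.tsum_mul_right, hK, ENNReal.coe_mul, mul_assoc]

theorem add_sq_le_weighted {ε : ℝ≥0} (hε : ε ≠ 0) (a b : ℝ≥0∞) :
    (a + b) ^ 2 ≤ (1 + ε) * a ^ 2 + (1 + ε⁻¹ : ℝ≥0) * b ^ 2 := by
  induction a with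
  | top => simp
  | coe a =>
    induction b with
    | top => simp
    | coe b =>
      norm_cast
      rw [← NNReal.coe_le_coe]
      push_cast
      have h : (0 : ℝ) < ε := by exact_mod_cast pos_iff_ne_zero.2 hε
      have h2 : 0 ≤ (ε : ℝ)⁻¹ * ((ε : ℝ) * a - b) ^ 2 := by positivity
      have h3 : (ε : ℝ)⁻¹ * ((ε : ℝ) * a - b) ^ 2 =
          ε * (a : ℝ) ^ 2 - 2 * a * b + (ε : ℝ)⁻¹ * b ^ 2 := by
        field_simp
        ring
      linarith

/-- Discrete Hardy inequality for sequences with controlled increments. -/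
theorem exists_tsum_sq_le_of_increments {τ : ℝ} (hτ : 0 < τ) (c : ℝ≥0) :
    ∃ K : ℝ≥0, ∀ m o : ℕ → ℝ≥0∞, (∀ k, m (k + 1) ≤ m k + c * o k) →
      ∑' k : ℕ, (2 : ℝ≥0∞) ^ (-(k * τ)) * m k ^ 2 ≤
        K * (m 0 ^ 2 + ∑' k : ℕ, (2 : ℝ≥0∞) ^ (-(k * τ)) * o k ^ 2) := by
  -- `ε` is chosen such that `θ = 2 ^ (-τ) (1 + ε) < 1`
  obtain ⟨ε, hε, hθ⟩ : ∃ ε : ℝ≥0, ε ≠ 0 ∧ (2 : ℝ≥0∞) ^ (-τ) * (1 + ε) < 1 := by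
    have h : Tendsto (fun ε : ℝ≥0 => (2 : ℝ≥0∞) ^ (-τ) * (1 + ε)) (𝓝[≠] 0)
        (𝓝 (2 ^ (-τ) * (1 + (0 : ℝ≥0)))) := by
      refine ENNReal.Tendsto.const_mul ?_ (Or.inr (two_rpow_ne_top _))
      exact (tendsto_const_nhds.add (ENNReal.tendsto_coe.2 tendsto_id)).mono_left
        nhdsWithin_le_nhds
    have h2 := h.eventually_lt_const (u := 1)
      (by simpa using two_rpow_lt_one (a := -τ) (by linarith))
    obtain ⟨ε, h3, h4⟩ := (h2.and self_mem_nhdsWithin).exists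
    exact ⟨ε, h4, h3⟩
  obtain ⟨K, hK⟩ := exists_one_add_mul_le hθ
  set A : ℝ≥0 := (1 + ε⁻¹) * c ^ 2 with hA
  refine ⟨K * (1 + A), fun m o h => ?_⟩
  set X := m 0 ^ 2 + A * ∑' k : ℕ, (2 : ℝ≥0∞) ^ (-(k * τ)) * o k ^ 2 with hX
  have hstep : ∀ k : ℕ, (2 : ℝ≥0∞) ^ (-(((k + 1 : ℕ) : ℝ) * τ)) * m (k + 1) ^ 2 ≤
      2 ^ (-τ) * (1 + ε) * (2 ^ (-(k * τ)) * m k ^ 2) + A * (2 ^ (-(k * τ)) * o k ^ 2) := by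
    intro k
    have e : (2 : ℝ≥0∞) ^ (-(((k + 1 : ℕ) : ℝ) * τ)) = 2 ^ (-τ) * 2 ^ (-(k * τ)) := by
      rw [← two_rpow_add]; push_cast; ring_nf
    calc _ ≤ (2 : ℝ≥0∞) ^ (-τ) * 2 ^ (-(k * τ)) *
          ((1 + ε) * m k ^ 2 + (1 + ε⁻¹ : ℝ≥0) * (c * o k) ^ 2) := by
          rw [e]
          gcongr
          exact (pow_le_pow_left' (h k) 2).trans (add_sq_le_weighted hε _ _)
      _ = 2 ^ (-τ) * (1 + ε) * (2 ^ (-(k * τ)) * m k ^ 2) +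
          2 ^ (-τ) * (A * (2 ^ (-(k * τ)) * o k ^ 2)) := by
          rw [hA, ENNReal.coe_mul, ENNReal.coe_pow]; ring
      _ ≤ _ := by
          refine add_le_add le_rfl ?_
          exact mul_le_of_le_one_left' (two_rpow_lt_one (a := -τ) (by linarith)).le
  have hpart : ∀ n : ℕ, ∑ k ∈ Finset.range n, (2 : ℝ≥0∞) ^ (-(k * τ)) * m k ^ 2 ≤ K * X := by
    intro n
    induction n with
    | zero => simp
    | succ n ih =>
      rw [Finset.sum_range_succ']
      calc _ ≤ ∑ k ∈ Finset.range n, ((2 : ℝ≥0∞) ^ (-τ) * (1 + ε) * (2 ^ (-(k * τ)) * m k ^ 2) +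
            A * (2 ^ (-(k * τ)) * o k ^ 2)) + m 0 ^ 2 := by
            gcongr with k
            · exact hstep k
            · simp
        _ ≤ (2 : ℝ≥0∞) ^ (-τ) * (1 + ε) * (K * X) + X := by
            rw [Finset.sum_add_distrib, ← Finset.mul_sum, ← Finset.mul_sum, add_assoc,
              add_comm (_ * _) (m 0 ^ 2), hX]
            gcongr
            exact ENNReal.sum_le_tsum _
        _ = (1 + 2 ^ (-τ) * (1 + ε) * K) * X := by ring
        _ ≤ K * X := by gcongr
  rw [ENNReal.tsum_eq_iSup_nat]
  refine (iSup_le hpart).trans ?_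
  rw [ENNReal.coe_mul, mul_assoc, ENNReal.coe_add, ENNReal.coe_one]
  gcongr
  rw [hX, mul_add]
  gcongr
  · exact le_mul_of_one_le_left' le_self_add
  · exact le_add_self

/-! ### Quadratic means and oscillations over balls -/

theorem eLpNorm_two_sq {α : Type*} [MeasurableSpace α] (f : α → ℂ) (μ : Measure α) :
    eLpNorm f 2 μ ^ 2 = ∫⁻ x, ‖f x‖ₑ ^ 2 ∂μ := by
  have h := eLpNorm_nnreal_pow_eq_lintegral (μ := μ) (f := f) (p := 2) two_ne_zero
  simp only [NNReal.coe_ofNat, ENNReal.rpow_two, ENNReal.coe_ofNat] at h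
  exact h

theorem le_of_sq_le_sq {a b : ℝ≥0∞} (h : a ^ 2 ≤ b ^ 2) : a ≤ b := by
  by_contra! hlt
  exact absurd h (not_le.2 (ENNReal.pow_lt_pow_left two_ne_zero hlt))

/-- The quadratic mean oscillation of `g` with respect to `P`. -/
noncomputable def oscillation {α : Type*} [MeasurableSpace α] (P : Measure α) (g : α → ℂ) : ℝ≥0∞ :=
  eLpNorm (fun p : α × α => g p.1 - g p.2) 2 (P.prod P)

section ProbabilityMeasures

variable {α : Type*} [MeasurableSpace α] {g : α → ℂ}

/-- Minkowski's inequality for `g(x) = (g(x) - g(y)) + g(y)` on the product of two probability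
spaces. -/
theorem eLpNorm_le_oscillation_add (hg : Measurable g) (P Q : Measure α)
    [IsProbabilityMeasure P] [IsProbabilityMeasure Q] :
    eLpNorm g 2 P ≤ eLpNorm (fun p : α × α => g p.1 - g p.2) 2 (P.prod Q) + eLpNorm g 2 Q := by
  rw [← eLpNorm_comp_measurePreserving hg.aestronglyMeasurable
      (measurePreserving_fst (μ := P) (ν := Q)),
    ← eLpNorm_comp_measurePreserving (μ := P.prod Q) hg.aestronglyMeasurable
      (measurePreserving_snd (μ := P) (ν := Q))]
  have e : g ∘ Prod.fst = (fun p : α × α => g p.1 - g p.2) + g ∘ Prod.snd := by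
    ext p; simp
  rw [e]
  refine eLpNorm_add_le ?_ ?_ one_le_two <;> exact Measurable.aestronglyMeasurable (by fun_prop)

theorem cond_le_smul_cond {μ : Measure α} {A B : Set α} (hAB : A ⊆ B) {c : ℝ≥0}
    (hc : μ B ≤ c * μ A) (hA : μ A ≠ 0) (hB : μ B ≠ ∞) :
    ProbabilityTheory.cond μ A ≤ c • ProbabilityTheory.cond μ B := by
  have hB0 : μ B ≠ 0 := fun h => hA (measure_mono_null hAB h)
  have hAT : μ A ≠ ∞ := ne_top_of_le_ne_top hB (measure_mono hAB)
  have h1 : (μ A)⁻¹ ≤ c * (μ B)⁻¹ := by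
    rw [← div_eq_mul_inv, ENNReal.le_div_iff_mul_le (Or.inl hB0) (Or.inl hB), mul_comm,
      ← div_eq_mul_inv]
    exact ENNReal.div_le_of_le_mul hc
  refine Measure.le_intro fun s hs _ => ?_
  simp only [ProbabilityTheory.cond, Measure.smul_apply, smul_eq_mul, ENNReal.smul_def]
  rw [← mul_assoc]
  exact mul_le_mul' h1 (Measure.restrict_mono hAB le_rfl _)

/-- The quadratic means over nested sets of comparable measure differ by at most an oscillation
over the larger set. -/
theorem eLpNorm_cond_le {μ : Measure α} {A B : Set α} (hAB : A ⊆ B) {c : ℝ≥0}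
    (hc : μ B ≤ c * μ A) (hA : μ A ≠ 0) (hB : μ B ≠ ∞) (hg : Measurable g) :
    eLpNorm g 2 (ProbabilityTheory.cond μ B) ≤
        (c ^ (1 / 2 : ℝ) : ℝ≥0) * oscillation (ProbabilityTheory.cond μ B) g +
          eLpNorm g 2 (ProbabilityTheory.cond μ A) ∧
      eLpNorm g 2 (ProbabilityTheory.cond μ A) ≤
        (c ^ (1 / 2 : ℝ) : ℝ≥0) * oscillation (ProbabilityTheory.cond μ B) g +
          eLpNorm g 2 (ProbabilityTheory.cond μ B) ∧
      eLpNorm g 2 (ProbabilityTheory.cond μ A) ≤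
        (c ^ (1 / 2 : ℝ) : ℝ≥0) * eLpNorm g 2 (ProbabilityTheory.cond μ B) := by
  have hle := cond_le_smul_cond hAB hc hA hB
  have hAT : μ A ≠ ∞ := ne_top_of_le_ne_top hB (measure_mono hAB)
  have hB0 : μ B ≠ 0 := fun h => hA (measure_mono_null hAB h)
  have := ProbabilityTheory.cond_isProbabilityMeasure_of_finite hA hAT
  have := ProbabilityTheory.cond_isProbabilityMeasure_of_finite hB0 hB
  set P := ProbabilityTheory.cond μ B
  set Q := ProbabilityTheory.cond μ A
  have hsm : ∀ {β : Type _} [MeasurableSpace β] (f : β → ℂ) (ν ν' : Measure β), ν ≤ c • ν' →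
      eLpNorm f 2 ν ≤ (c ^ (1 / 2 : ℝ) : ℝ≥0) * eLpNorm f 2 ν' := by
    intro β _ f ν ν' h
    refine (eLpNorm_mono_measure f h).trans_eq ?_
    have := eLpNorm_smul_measure_of_ne_top (p := 2) (μ := ν') ENNReal.ofNat_ne_top f (c : ℝ≥0∞)
    rw [ENNReal.smul_def, this, smul_eq_mul, ENNReal.coe_rpow_of_nonneg _ (by norm_num)]
    norm_num
  refine ⟨(eLpNorm_le_oscillation_add hg P Q).trans ?_,
    (eLpNorm_le_oscillation_add hg Q P).trans ?_, hsm _ _ _ hle⟩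
  · gcongr
    refine hsm _ _ _ ?_
    rw [← Measure.prod_smul_right]
    exact Measure.prod_mono le_rfl hle
  · gcongr
    refine hsm _ _ _ ?_
    rw [← Measure.prod_smul_left]
    exact Measure.prod_mono hle le_rfl

theorem eLpNorm_le_enorm_integral_add_oscillation {P : Measure α} [IsProbabilityMeasure P]
    (hg : Measurable g) (hgP : MemLp g 2 P) :
    eLpNorm g 2 P ≤ ‖∫ x, g x ∂P‖ₑ + oscillation P g := by
  set A := ∫ x, g x ∂P with hA
  have hint : Integrable g P := hgP.integrable one_le_two
  have h1 : eLpNorm (fun x => g x - A) 2 P ≤ oscillation P g := by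
    refine le_of_sq_le_sq ?_
    rw [eLpNorm_two_sq, oscillation, eLpNorm_two_sq, lintegral_prod _ (by fun_prop)]
    refine lintegral_mono fun x => ?_
    simp only
    rw [← eLpNorm_two_sq]
    refine pow_le_pow_left' ?_ 2
    have e : g x - A = ∫ y, (g x - g y) ∂P := by
      rw [integral_sub (integrable_const _) hint]; simp [hA]
    calc ‖g x - A‖ₑ ≤ ∫⁻ y, ‖g x - g y‖ₑ ∂P := by
          rw [e]; exact enorm_integral_le_lintegral_enorm _
      _ = eLpNorm (fun y => g x - g y) 1 P := (eLpNorm_one_eq_lintegral_enorm).symm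
      _ ≤ _ := eLpNorm_le_eLpNorm_of_exponent_le one_le_two
          (Measurable.aestronglyMeasurable (by fun_prop))
  calc eLpNorm g 2 P = eLpNorm ((fun _ => A) + fun x => g x - A) 2 P := by
        congr 1; ext x; simp
    _ ≤ eLpNorm (fun _ : α => A) 2 P + eLpNorm (fun x => g x - A) 2 P :=
        eLpNorm_add_le (by fun_prop) (Measurable.aestronglyMeasurable (by fun_prop)) one_le_two
    _ ≤ _ := by
        gcongr
        rw [eLpNorm_const _ two_ne_zero (IsProbabilityMeasure.ne_zero P)]
        simp

end ProbabilityMeasures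

/-- The dyadic radius `2 ^ (-(k+1))`; with this indexing two points of a ball of radius `rad k`
have distance less than `2⁻ᵏ ≤ 1`. -/
noncomputable def rad (k : ℕ) : ℝ := (1 / 2) ^ (k + 1)

theorem rad_pos (k : ℕ) : 0 < rad k := by unfold rad; positivity

theorem ofReal_rad (k : ℕ) : ENNReal.ofReal (rad k) = 2 ^ (-((k : ℝ) + 1)) := by
  rw [rad, ENNReal.ofReal_pow (by positivity), ENNReal.ofReal_div_of_pos two_pos,
    ENNReal.ofReal_one, ENNReal.ofReal_ofNat, one_div, ENNReal.rpow_neg, ← ENNReal.inv_pow,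
    ← Nat.cast_succ, ENNReal.rpow_natCast]

/-- The uniform probability measure on the ball `B(x, rad k)`. -/
noncomputable def ballMeasure (k : ℕ) (x : EuclideanSpace ℝ (Fin d)) :
    Measure (EuclideanSpace ℝ (Fin d)) :=
  ProbabilityTheory.cond volume (Metric.ball x (rad k))

instance (k : ℕ) (x : EuclideanSpace ℝ (Fin d)) : IsProbabilityMeasure (ballMeasure k x) :=
  ProbabilityTheory.cond_isProbabilityMeasure_of_finite
    (Metric.measure_ball_pos _ _ (rad_pos k)).ne' measure_ball_lt_top.ne

/-- The quadratic mean of `g` over `B(x, rad k)`. -/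
noncomputable def meanSq (g : EuclideanSpace ℝ (Fin d) → ℂ) (k : ℕ)
    (x : EuclideanSpace ℝ (Fin d)) : ℝ≥0∞ :=
  eLpNorm g 2 (ballMeasure k x)

/-- The quadratic oscillation of `g` over `B(x, rad k)`. -/
noncomputable def osc (g : EuclideanSpace ℝ (Fin d) → ℂ) (k : ℕ)
    (x : EuclideanSpace ℝ (Fin d)) : ℝ≥0∞ :=
  oscillation (ballMeasure k x) g

theorem volume_ball_rad (k : ℕ) (x : EuclideanSpace ℝ (Fin d)) :
    volume (Metric.ball x (rad k)) = 2 ^ (-(((k : ℝ) + 1) * d)) *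
      volume (Metric.ball (0 : EuclideanSpace ℝ (Fin d)) 1) := by
  rw [volume_ball_eq _ (rad_pos k), ofReal_rad, ← ENNReal.rpow_natCast, ← ENNReal.rpow_mul]
  ring_nf

/-- Halving the radius changes the quadratic mean by at most `2 ^ (d/2)` times the oscillation. -/
theorem exists_meanSq_le_osc_add (d : ℕ) : ∃ c : ℝ≥0, ∀ g : EuclideanSpace ℝ (Fin d) → ℂ,
    Measurable g → ∀ k x, meanSq g k x ≤ c * osc g k x + meanSq g (k + 1) x ∧
      meanSq g (k + 1) x ≤ c * osc g k x + meanSq g k x := by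
  refine ⟨(2 ^ d) ^ (1 / 2 : ℝ), fun g hg k x => ?_⟩
  have h := eLpNorm_cond_le (μ := volume) (A := Metric.ball x (rad (k + 1)))
    (B := Metric.ball x (rad k)) (c := 2 ^ d) ?_ ?_
    (Metric.measure_ball_pos _ _ (rad_pos _)).ne' measure_ball_lt_top.ne hg
  · exact ⟨h.1, h.2.1⟩
  · refine Metric.ball_subset_ball ?_
    rw [rad, rad, pow_succ _ (k + 1)]
    have : (0 : ℝ) < (1 / 2) ^ (k + 1) := by positivity
    linarith
  · rw [volume_ball_rad, volume_ball_rad, ← mul_assoc]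
    refine mul_le_mul' (le_of_eq ?_) le_rfl
    rw [ENNReal.coe_pow, ENNReal.coe_ofNat, ← ENNReal.rpow_natCast, ← two_rpow_add]
    congr 1; push_cast; ring

/-- The indicator function of `dist x y < rad k`. -/
noncomputable def near (k : ℕ) (x y : EuclideanSpace ℝ (Fin d)) : ℝ≥0∞ :=
  (Metric.ball x (rad k)).indicator 1 y

theorem near_comm (k : ℕ) (x y : EuclideanSpace ℝ (Fin d)) : near k x y = near k y x := by
  simp [near, indicator, dist_comm]

@[fun_prop]
theorem measurable_near (k : ℕ) :
    Measurable fun p : EuclideanSpace ℝ (Fin d) × EuclideanSpace ℝ (Fin d) => near k p.1 p.2 :=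
  (measurable_const (a := (1 : ℝ≥0∞))).indicator
    (isOpen_lt (continuous_snd.dist continuous_fst) continuous_const).measurableSet

theorem lintegral_near (k : ℕ) (y : EuclideanSpace ℝ (Fin d))
    (m : Measure (EuclideanSpace ℝ (Fin d))) :
    ∫⁻ x, near k x y ∂m = m (Metric.ball y (rad k)) := by
  simp_rw [near_comm k _ y, near]
  rw [lintegral_indicator_one Metric.isOpen_ball.measurableSet]

theorem near_mul_near_le (k : ℕ) (x y z : EuclideanSpace ℝ (Fin d)) :
    near k x y * near k x z ≤ if edist y z < 2 ^ (-(k : ℝ)) then near k x y else 0 := by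
  by_cases hy : y ∈ Metric.ball x (rad k)
  · by_cases hz : z ∈ Metric.ball x (rad k)
    · have h : edist y z < 2 ^ (-(k : ℝ)) := by
        have e : (2 : ℝ≥0∞) ^ (-(k : ℝ)) = ENNReal.ofReal (2 * rad k) := by
          rw [ENNReal.ofReal_mul two_pos.le, ofReal_rad, ENNReal.ofReal_ofNat]
          conv_rhs => rw [← ENNReal.rpow_one 2, ← ENNReal.rpow_mul, one_mul, ← two_rpow_add]
          ring_nf
        rw [e, edist_dist, ENNReal.ofReal_lt_ofReal_iff (by have := rad_pos k; positivity)]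
        have := dist_triangle_right y z x
        rw [Metric.mem_ball] at hy hz
        linarith
      rw [if_pos h]
      simp [near, hy, hz]
    · simp [near, hz]
  · simp [near, hy]

theorem meanSq_sq (g : EuclideanSpace ℝ (Fin d) → ℂ) (k : ℕ) (x : EuclideanSpace ℝ (Fin d)) :
    meanSq g k x ^ 2 = (volume (Metric.ball (0 : EuclideanSpace ℝ (Fin d)) 1))⁻¹ *
      2 ^ (((k : ℝ) + 1) * d) * ∫⁻ y, near k x y * ‖g y‖ₑ ^ 2 := by
  have e : (fun y => near k x y * ‖g y‖ₑ ^ 2) =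
      (Metric.ball x (rad k)).indicator (fun y => ‖g y‖ₑ ^ 2) := by
    ext y; simp [near, indicator]
  rw [e, meanSq, eLpNorm_two_sq, ballMeasure, ProbabilityTheory.cond, lintegral_smul_measure,
    volume_ball_rad, lintegral_indicator Metric.isOpen_ball.measurableSet, smul_eq_mul,
    ENNReal.mul_inv (Or.inl (two_rpow_ne_zero _)) (Or.inl (two_rpow_ne_top _)),
    ← ENNReal.rpow_neg, neg_neg, mul_comm (2 ^ _)]

theorem osc_sq {g : EuclideanSpace ℝ (Fin d) → ℂ} (hg : Measurable g) (k : ℕ)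
    (x : EuclideanSpace ℝ (Fin d)) :
    osc g k x ^ 2 = (volume (Metric.ball (0 : EuclideanSpace ℝ (Fin d)) 1))⁻¹ ^ 2 *
      2 ^ (2 * ((k : ℝ) + 1) * d) *
      ∫⁻ y, ∫⁻ z, near k x y * near k x z * ‖g y - g z‖ₑ ^ 2 := by
  have hb : MeasurableSet (Metric.ball x (rad k) ×ˢ Metric.ball x (rad k)) :=
    Metric.isOpen_ball.measurableSet.prod Metric.isOpen_ball.measurableSet
  have hm : Measurable fun p : EuclideanSpace ℝ (Fin d) × EuclideanSpace ℝ (Fin d) =>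
      ‖g p.1 - g p.2‖ₑ ^ 2 := by fun_prop
  have e0 : ∀ y z, near k x y * near k x z * ‖g y - g z‖ₑ ^ 2 =
      (Metric.ball x (rad k) ×ˢ Metric.ball x (rad k)).indicator
        (fun p => ‖g p.1 - g p.2‖ₑ ^ 2) (y, z) := fun y z => by
    by_cases hy : y ∈ Metric.ball x (rad k) <;> by_cases hz : z ∈ Metric.ball x (rad k) <;>
      simp [near, hy, hz, indicator]
  simp_rw [e0]
  rw [osc, oscillation, eLpNorm_two_sq, ballMeasure, ProbabilityTheory.cond,
    ← lintegral_prod _ (hm.indicator hb).aemeasurable, lintegral_indicator hb,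
    ← Measure.prod_restrict, Measure.prod_smul_left, Measure.prod_smul_right,
    lintegral_smul_measure, lintegral_smul_measure, smul_eq_mul, smul_eq_mul, ← mul_assoc,
    volume_ball_rad, ENNReal.mul_inv (Or.inl (two_rpow_ne_zero _)) (Or.inl (two_rpow_ne_top _)),
    ← ENNReal.rpow_neg, neg_neg]
  have e : (2 : ℝ≥0∞) ^ (2 * ((k : ℝ) + 1) * d) =
      2 ^ (((k : ℝ) + 1) * d) * 2 ^ (((k : ℝ) + 1) * d) := by
    rw [← two_rpow_add]; ring_nf
  rw [e]
  ring

/-! ### Integrating means and oscillations over the Dirichlet part -/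

/-- The square of the seminorm on `ℝᵈ`, as a double integral. -/
noncomputable def energy (s : ℝ) (g : EuclideanSpace ℝ (Fin d) → ℂ) : ℝ≥0∞ :=
  ∫⁻ x, ∫⁻ y in Metric.ball x 1, ‖g x - g y‖ₑ ^ 2 / edist x y ^ (d + 2 * s)

theorem measurable_meanSq_sq {g : EuclideanSpace ℝ (Fin d) → ℂ} (hg : Measurable g) (k : ℕ) :
    Measurable fun x => meanSq g k x ^ 2 := by
  simp_rw [meanSq_sq]
  refine Measurable.const_mul (Measurable.lintegral_prod_right' (ν := volume)
    (f := fun p : EuclideanSpace ℝ (Fin d) × EuclideanSpace ℝ (Fin d) =>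
      near k p.1 p.2 * ‖g p.2‖ₑ ^ 2) ?_) _
  fun_prop

theorem measurable_osc_sq {g : EuclideanSpace ℝ (Fin d) → ℂ} (hg : Measurable g) (k : ℕ) :
    Measurable fun x => osc g k x ^ 2 := by
  simp_rw [osc_sq hg]
  refine Measurable.const_mul (Measurable.lintegral_prod_right' (ν := volume)
    (f := fun p : EuclideanSpace ℝ (Fin d) × EuclideanSpace ℝ (Fin d) =>
      ∫⁻ z, near k p.1 p.2 * near k p.1 z * ‖g p.2 - g z‖ₑ ^ 2)
    (Measurable.lintegral_prod_right' (ν := volume)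
      (f := fun q : (EuclideanSpace ℝ (Fin d) × EuclideanSpace ℝ (Fin d)) ×
        EuclideanSpace ℝ (Fin d) =>
          near k q.1.1 q.1.2 * near k q.1.1 q.2 * ‖g q.1.2 - g q.2‖ₑ ^ 2) ?_)) _
  fun_prop

theorem lintegral_swap_three {α : Type*} [MeasurableSpace α] (m ν : Measure α) [SFinite m]
    [SFinite ν] {F : α → α → α → ℝ≥0∞} (hF : Measurable fun p : (α × α) × α => F p.1.1 p.1.2 p.2) :
    ∫⁻ x, ∫⁻ y, ∫⁻ z, F x y z ∂ν ∂ν ∂m = ∫⁻ y, ∫⁻ z, ∫⁻ x, F x y z ∂m ∂ν ∂ν := by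
  rw [lintegral_lintegral_swap]
  · refine lintegral_congr fun y => ?_
    rw [lintegral_lintegral_swap]
    exact (hF.comp (by fun_prop : Measurable fun p : α × α => ((p.1, y), p.2))).aemeasurable
  · exact (hF.lintegral_prod_right' (ν := ν)).aemeasurable

theorem lintegral_meanSq_zero_le {m : Measure (EuclideanSpace ℝ (Fin d))} [IsFiniteMeasure m] :
    ∃ K : ℝ≥0, ∀ g : EuclideanSpace ℝ (Fin d) → ℂ, Measurable g →
      ∫⁻ x, meanSq g 0 x ^ 2 ∂m ≤ K * ∫⁻ y, ‖g y‖ₑ ^ 2 := by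
  set V := (volume (Metric.ball (0 : EuclideanSpace ℝ (Fin d)) 1))⁻¹ * 2 ^ (((0 : ℕ) + 1 : ℝ) * d)
    with hV
  have hVT : V ≠ ∞ := ENNReal.mul_ne_top
    (ENNReal.inv_ne_top.2 (Metric.measure_ball_pos _ _ one_pos).ne') (two_rpow_ne_top _)
  refine ⟨V.toNNReal * (m univ).toNNReal, fun g hg => ?_⟩
  rw [ENNReal.coe_mul, ENNReal.coe_toNNReal hVT, ENNReal.coe_toNNReal (measure_ne_top _ _)]
  calc _ ≤ ∫⁻ _, (V * ∫⁻ y, ‖g y‖ₑ ^ 2) ∂m := by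
        refine lintegral_mono fun x => ?_
        simp only [meanSq_sq]
        refine mul_le_mul' le_rfl (lintegral_mono fun y => mul_le_of_le_one_left' ?_)
        exact indicator_le_self _ _ _
    _ = _ := by rw [lintegral_const]; ring

/-- The oscillations over balls centred on a `(d-1)`-dimensional set, with the scale weights
`2 ^ (k (2s-1))`, are controlled by the seminorm: for two points at distance `t`, the balls
containing both are those of radius at least about `t`, and summing their weights produces the
kernel `t ^ (-(d + 2s))`. -/
theorem exists_lintegral_tsum_osc_le {m : Measure (EuclideanSpace ℝ (Fin d))} [SFinite m]
    (hm : UpperRegular m ((d : ℝ) - 1)) {s : ℝ} (hs : 0 < s) :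
    ∃ K : ℝ≥0, ∀ g : EuclideanSpace ℝ (Fin d) → ℂ, Measurable g →
      ∫⁻ x, ∑' k : ℕ, (2 : ℝ≥0∞) ^ (k * (2 * s - 1)) * osc g k x ^ 2 ∂m ≤ K * energy s g := by
  obtain ⟨C, hC⟩ := hm
  have ha : 0 < (d : ℝ) + 2 * s := by positivity
  obtain ⟨K, hK⟩ := exists_tsum_ite_le ha
  set V := (volume (Metric.ball (0 : EuclideanSpace ℝ (Fin d)) 1))⁻¹ ^ 2 with hV
  have hVT : V ≠ ∞ := ENNReal.pow_ne_top
    (ENNReal.inv_ne_top.2 (Metric.measure_ball_pos _ _ one_pos).ne')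
  set A : ℝ≥0∞ := V * C * 2 ^ ((d : ℝ) + 1) with hA
  have hAT : A ≠ ∞ := ENNReal.mul_ne_top (ENNReal.mul_ne_top hVT ENNReal.coe_ne_top)
    (two_rpow_ne_top _)
  refine ⟨A.toNNReal * K, fun g hg => ?_⟩
  rw [ENNReal.coe_mul, ENNReal.coe_toNNReal hAT]
  have hscale : ∀ k : ℕ, ∫⁻ x, (2 : ℝ≥0∞) ^ (k * (2 * s - 1)) * osc g k x ^ 2 ∂m ≤
      ∫⁻ y, ∫⁻ z, A * ((if edist y z < 2 ^ (-(k : ℝ)) then (2 : ℝ≥0∞) ^ (k * (d + 2 * s)) else 0) *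
        ‖g y - g z‖ₑ ^ 2) := by
    intro k
    have hF : Measurable fun p : (EuclideanSpace ℝ (Fin d) × EuclideanSpace ℝ (Fin d)) ×
        EuclideanSpace ℝ (Fin d) =>
        near k p.1.1 p.1.2 * near k p.1.1 p.2 * ‖g p.1.2 - g p.2‖ₑ ^ 2 := by fun_prop
    set w : ℝ≥0∞ := (2 : ℝ≥0∞) ^ (k * (2 * s - 1)) * (V * 2 ^ (2 * ((k : ℝ) + 1) * d)) with hw
    have hwT : w ≠ ∞ := ENNReal.mul_ne_top (two_rpow_ne_top _)
      (ENNReal.mul_ne_top hVT (two_rpow_ne_top _))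
    calc _ = w * ∫⁻ x, ∫⁻ y, ∫⁻ z,
          near k x y * near k x z * ‖g y - g z‖ₑ ^ 2 ∂volume ∂volume ∂m := by
          rw [← lintegral_const_mul' _ _ hwT]
          refine lintegral_congr fun x => ?_
          rw [osc_sq hg, hw, hV]
          ring
      _ = ∫⁻ y, ∫⁻ z, w * ∫⁻ x, near k x y * near k x z * ‖g y - g z‖ₑ ^ 2 ∂m := by
          rw [lintegral_swap_three m volume hF, ← lintegral_const_mul' _ _ hwT]
          simp_rw [← lintegral_const_mul' _ _ hwT]
      _ ≤ _ := by
          refine lintegral_mono fun y => lintegral_mono fun z => ?_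
          rw [lintegral_mul_const _ (by fun_prop), ← mul_assoc, ← mul_assoc]
          refine mul_le_mul' ?_ le_rfl
          calc w * ∫⁻ x, near k x y * near k x z ∂m
              ≤ w * ∫⁻ x, (if edist y z < 2 ^ (-(k : ℝ)) then near k x y else 0) ∂m :=
                mul_le_mul' le_rfl (lintegral_mono fun x => near_mul_near_le k x y z)
            _ ≤ _ := by
                split_ifs
                · rw [lintegral_near]
                  refine (mul_le_mul' le_rfl (hC y _ (rad_pos k))).trans_eq ?_
                  rw [ofReal_rad, ← ENNReal.rpow_mul, hw, hA]
                  calc _ = V * C * (2 ^ (k * (2 * s - 1)) * 2 ^ (2 * ((k : ℝ) + 1) * d) *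
                        2 ^ (-((k : ℝ) + 1) * ((d : ℝ) - 1))) := by ring
                    _ = V * C * (2 ^ ((d : ℝ) + 1) * 2 ^ (k * (d + 2 * s))) := by
                        rw [← two_rpow_add, ← two_rpow_add, ← two_rpow_add]; ring_nf
                    _ = _ := by ring
                · simp
  calc _ = ∑' k : ℕ, ∫⁻ x, (2 : ℝ≥0∞) ^ (k * (2 * s - 1)) * osc g k x ^ 2 ∂m :=
        lintegral_tsum fun k => ((measurable_osc_sq hg k).const_mul _).aemeasurable
    _ ≤ ∑' k : ℕ, ∫⁻ y, ∫⁻ z, A * ((if edist y z < 2 ^ (-(k : ℝ)) then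
        (2 : ℝ≥0∞) ^ (k * (d + 2 * s)) else 0) * ‖g y - g z‖ₑ ^ 2) := ENNReal.tsum_le_tsum hscale
    _ = ∫⁻ y, ∫⁻ z, A * ((∑' k : ℕ, (if edist y z < 2 ^ (-(k : ℝ)) then
        (2 : ℝ≥0∞) ^ (k * (d + 2 * s)) else 0)) * ‖g y - g z‖ₑ ^ 2) := by
        have hms : ∀ k : ℕ, Measurable fun p : EuclideanSpace ℝ (Fin d) × EuclideanSpace ℝ (Fin d) =>
            A * ((if edist p.1 p.2 < 2 ^ (-(k : ℝ)) then (2 : ℝ≥0∞) ^ (k * (d + 2 * s)) else 0) *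
              ‖g p.1 - g p.2‖ₑ ^ 2) := fun k => by
          refine Measurable.const_mul (Measurable.mul (Measurable.ite ?_ (by fun_prop)
            (by fun_prop)) (by fun_prop)) _
          exact (isOpen_lt (continuous_fst.edist continuous_snd) continuous_const).measurableSet
        rw [← lintegral_tsum fun k => ((hms k).lintegral_prod_right').aemeasurable]
        refine lintegral_congr fun y => ?_
        refine (lintegral_tsum fun k =>
          ((hms k).comp measurable_prodMk_left).aemeasurable).symm.trans ?_
        refine lintegral_congr fun z => ?_
        simp only [Function.comp]
        rw [ENNReal.tsum_mul_left, ENNReal.tsum_mul_right]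
    _ ≤ ∫⁻ y, A * (K * ∫⁻ z in Metric.ball y 1,
          ‖g y - g z‖ₑ ^ 2 / edist y z ^ (d + 2 * s)) := by
        refine lintegral_mono fun y => ?_
        rw [← lintegral_indicator Metric.isOpen_ball.measurableSet,
          ← lintegral_const_mul' _ _ ENNReal.coe_ne_top, ← lintegral_const_mul' _ _ hAT]
        refine lintegral_mono fun z => mul_le_mul' le_rfl ?_
        by_cases hz : z ∈ Metric.ball y 1
        · rw [indicator_of_mem hz, div_eq_mul_inv, mul_comm (‖g y - g z‖ₑ ^ 2), ← mul_assoc]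
          exact mul_le_mul' (hK _) le_rfl
        · have h0 : ∀ k : ℕ, ¬ edist y z < 2 ^ (-(k : ℝ)) := fun k => by
            rw [not_lt]
            refine (two_rpow_le_two_rpow (b := 0) (by simp)).trans ?_
            rw [ENNReal.rpow_zero, edist_comm, edist_dist, ENNReal.one_le_ofReal]
            simpa using hz
          simp [h0]
    _ = _ := by
        rw [lintegral_const_mul' _ _ hAT, lintegral_const_mul' _ _ ENNReal.coe_ne_top, energy]
        exact (mul_assoc _ _ _).symm

/-- The mass of `g` in a tube around `D` is controlled by its means over balls centred on `D`. -/
theorem exists_setLIntegral_thickening_le {D : Set (EuclideanSpace ℝ (Fin d))}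
    {m : Measure (EuclideanSpace ℝ (Fin d))} [SFinite m] {c : ℝ≥0} (hc : c ≠ 0)
    (hlow : ∀ p ∈ D, ∀ r : ℝ, 0 < r → r ≤ 1 →
      c * ENNReal.ofReal r ^ ((d : ℝ) - 1) ≤ m (Metric.ball p r)) :
    ∃ K : ℝ≥0, ∀ g : EuclideanSpace ℝ (Fin d) → ℂ, Measurable g → ∀ k : ℕ,
      ∫⁻ x in Metric.thickening (rad (k + 1)) D, ‖g x‖ₑ ^ 2 ≤
        K * (2 ^ (-(k : ℝ)) * ∫⁻ x, meanSq g k x ^ 2 ∂m) := by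
  set V := volume (Metric.ball (0 : EuclideanSpace ℝ (Fin d)) 1) with hV
  have hVT : V ≠ ∞ := measure_ball_lt_top.ne
  have hV0 : V ≠ 0 := (Metric.measure_ball_pos _ _ one_pos).ne'
  set B : ℝ≥0∞ := V * 2 ^ ((d : ℝ) - 2) with hB
  have hBT : B ≠ ∞ := ENNReal.mul_ne_top hVT (two_rpow_ne_top _)
  refine ⟨c⁻¹ * B.toNNReal, fun g hg k => ?_⟩
  rw [ENNReal.coe_mul, ENNReal.coe_inv hc, ENNReal.coe_toNNReal hBT]
  set q : ℝ≥0∞ := 2 ^ (-((k : ℝ) + 2) * ((d : ℝ) - 1)) with hq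
  have hpt : ∀ x ∈ Metric.thickening (rad (k + 1)) D, (c * q) ≤ m (Metric.ball x (rad k)) := by
    intro x hx
    obtain ⟨p, hp, hxp⟩ := Metric.mem_thickening_iff.1 hx
    have e2 : rad (k + 1) + rad (k + 1) = rad k := by
      rw [rad, rad, pow_succ _ (k + 1)]; ring
    have h1 : rad (k + 1) ≤ 1 := pow_le_one₀ (by norm_num) (by norm_num)
    refine le_trans (le_of_eq ?_) ((hlow p hp _ (rad_pos (k + 1)) h1).trans (measure_mono ?_))
    · rw [ofReal_rad, ← ENNReal.rpow_mul, hq]; push_cast; ring_nf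
    · refine Metric.ball_subset_ball' ?_
      rw [dist_comm] at hxp
      linarith
  have hmain : (c * q) * ∫⁻ x in Metric.thickening (rad (k + 1)) D, ‖g x‖ₑ ^ 2 ≤
      V * 2 ^ (-(((k : ℝ) + 1) * d)) * ∫⁻ x, meanSq g k x ^ 2 ∂m := by
    calc _ = ∫⁻ y in Metric.thickening (rad (k + 1)) D, (c * q) * ‖g y‖ₑ ^ 2 := by
          rw [lintegral_const_mul _ (by fun_prop)]
      _ ≤ ∫⁻ y in Metric.thickening (rad (k + 1)) D, m (Metric.ball y (rad k)) * ‖g y‖ₑ ^ 2 :=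
          setLIntegral_mono' Metric.isOpen_thickening.measurableSet fun y hy =>
            mul_le_mul' (hpt y hy) le_rfl
      _ ≤ ∫⁻ y, m (Metric.ball y (rad k)) * ‖g y‖ₑ ^ 2 := setLIntegral_le_lintegral _ _
      _ = ∫⁻ y, ∫⁻ x, near k x y * ‖g y‖ₑ ^ 2 ∂m := by
          refine lintegral_congr fun y => ?_
          rw [lintegral_mul_const _ (by fun_prop), lintegral_near]
      _ = ∫⁻ x, ∫⁻ y, near k x y * ‖g y‖ₑ ^ 2 ∂volume ∂m := by
          refine lintegral_lintegral_swap (Measurable.aemeasurable ?_)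
          unfold Function.uncurry
          fun_prop
      _ = _ := by
          rw [← lintegral_const_mul' _ _ (ENNReal.mul_ne_top hVT (two_rpow_ne_top _))]
          refine lintegral_congr fun x => ?_
          rw [meanSq_sq]
          have e1 : V * V⁻¹ = 1 := ENNReal.mul_inv_cancel hV0 hVT
          have e2 : (2 : ℝ≥0∞) ^ (-(((k : ℝ) + 1) * d)) * 2 ^ (((k : ℝ) + 1) * d) = 1 := by
            rw [← two_rpow_add, neg_add_cancel, ENNReal.rpow_zero]
          calc _ = (V * V⁻¹) * ((2 : ℝ≥0∞) ^ (-(((k : ℝ) + 1) * d)) * 2 ^ (((k : ℝ) + 1) * d)) *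
                ∫⁻ y, near k x y * ‖g y‖ₑ ^ 2 := by rw [e1, e2, one_mul, one_mul]
            _ = _ := by ring
  have hq0 : q ≠ 0 := two_rpow_ne_zero _
  have hqT : q ≠ ∞ := two_rpow_ne_top _
  have hcq0 : (c : ℝ≥0∞) * q ≠ 0 := mul_ne_zero (by simpa using hc) hq0
  have hcqT : (c : ℝ≥0∞) * q ≠ ∞ := ENNReal.mul_ne_top ENNReal.coe_ne_top hqT
  have h2 := (ENNReal.le_div_iff_mul_le (Or.inl hcq0) (Or.inl hcqT)).2
    ((mul_comm _ _).trans_le hmain)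
  refine h2.trans_eq ?_
  rw [div_eq_mul_inv, ENNReal.mul_inv (Or.inr hqT) (Or.inr hq0), hq, ← ENNReal.rpow_neg, hB]
  calc _ = (c : ℝ≥0∞)⁻¹ * V * (2 ^ (-(-((k : ℝ) + 2) * ((d : ℝ) - 1))) *
        2 ^ (-(((k : ℝ) + 1) * d))) * ∫⁻ x, meanSq g k x ^ 2 ∂m := by ring
    _ = (c : ℝ≥0∞)⁻¹ * V * (2 ^ ((d : ℝ) - 2) * 2 ^ (-(k : ℝ))) *
        ∫⁻ x, meanSq g k x ^ 2 ∂m := by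
        rw [← two_rpow_add, ← two_rpow_add]; ring_nf
    _ = _ := by ring

/-! ### Hardy's inequality -/

/-- The weighted sum of the masses of `g` in the dyadic tubes around `D`; it is comparable to
`∫ |g|² dist(x, D) ^ (-2s)` over a tube. -/
noncomputable def hardySum (s : ℝ) (D : Set (EuclideanSpace ℝ (Fin d)))
    (g : EuclideanSpace ℝ (Fin d) → ℂ) : ℝ≥0∞ :=
  ∑' k : ℕ, (2 : ℝ≥0∞) ^ (k * (2 * s)) *
    ∫⁻ x in Metric.thickening (rad (k + 1)) D, ‖g x‖ₑ ^ 2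

theorem exists_hardySum_le_lintegral_tsum_meanSq {D : Set (EuclideanSpace ℝ (Fin d))}
    {m : Measure (EuclideanSpace ℝ (Fin d))} [SFinite m] {c : ℝ≥0} (hc : c ≠ 0)
    (hlow : ∀ p ∈ D, ∀ r : ℝ, 0 < r → r ≤ 1 →
      c * ENNReal.ofReal r ^ ((d : ℝ) - 1) ≤ m (Metric.ball p r)) (s : ℝ) :
    ∃ K : ℝ≥0, ∀ g : EuclideanSpace ℝ (Fin d) → ℂ, Measurable g →
      hardySum s D g ≤ K * ∫⁻ x, ∑' k : ℕ, (2 : ℝ≥0∞) ^ (k * (2 * s - 1)) * meanSq g k x ^ 2 ∂m := by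
  obtain ⟨K, hK⟩ := exists_setLIntegral_thickening_le hc hlow
  refine ⟨K, fun g hg => ?_⟩
  rw [lintegral_tsum fun k => ((measurable_meanSq_sq hg k).const_mul _).aemeasurable, hardySum,
    ← ENNReal.tsum_mul_left]
  refine ENNReal.tsum_le_tsum fun k => ?_
  rw [lintegral_const_mul' _ _ (two_rpow_ne_top _)]
  refine (mul_le_mul' le_rfl (hK g hg k)).trans_eq ?_
  have e : (2 : ℝ≥0∞) ^ (k * (2 * s - 1)) = 2 ^ (k * (2 * s)) * 2 ^ (-(k : ℝ)) := by
    rw [← two_rpow_add]; ring_nf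
  rw [e]; ring

/-- For `s < 1/2` no boundary condition is needed: the means over small balls are reached from the
mean over the ball of radius `rad 0`. -/
theorem exists_hardySum_le_of_lt_half {D : Set (EuclideanSpace ℝ (Fin d))}
    {m : Measure (EuclideanSpace ℝ (Fin d))} [IsFiniteMeasure m] {c : ℝ≥0} (hc : c ≠ 0)
    (hlow : ∀ p ∈ D, ∀ r : ℝ, 0 < r → r ≤ 1 →
      c * ENNReal.ofReal r ^ ((d : ℝ) - 1) ≤ m (Metric.ball p r))
    (hup : UpperRegular m ((d : ℝ) - 1)) {s : ℝ} (hs0 : 0 < s) (hs : s < 1 / 2) :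
    ∃ K : ℝ≥0, ∀ g : EuclideanSpace ℝ (Fin d) → ℂ, Measurable g →
      hardySum s D g ≤ K * ((∫⁻ x, ‖g x‖ₑ ^ 2) + energy s g) := by
  obtain ⟨K₁, hK₁⟩ := exists_hardySum_le_lintegral_tsum_meanSq hc hlow s
  obtain ⟨b, hb⟩ := exists_meanSq_le_osc_add d
  obtain ⟨K₂, hK₂⟩ := exists_tsum_sq_le_of_increments (τ := 1 - 2 * s) (by linarith) b
  obtain ⟨K₃, hK₃⟩ := exists_lintegral_tsum_osc_le hup hs0
  obtain ⟨K₄, hK₄⟩ := lintegral_meanSq_zero_le (m := m)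
  refine ⟨K₁ * (K₂ * (K₃ + K₄)), fun g hg => (hK₁ g hg).trans ?_⟩
  have e : ∀ k : ℕ, (k : ℝ) * (2 * s - 1) = -(k * (1 - 2 * s)) := fun k => by ring
  rw [ENNReal.coe_mul, mul_assoc]
  refine mul_le_mul' le_rfl ?_
  calc _ ≤ ∫⁻ x, K₂ * (meanSq g 0 x ^ 2 +
        ∑' k : ℕ, (2 : ℝ≥0∞) ^ (k * (2 * s - 1)) * osc g k x ^ 2) ∂m := by
        refine lintegral_mono fun x => ?_
        simp only [e]
        exact hK₂ (fun k => meanSq g k x) (fun k => osc g k x) fun k =>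
          ((hb g hg k x).2).trans_eq (add_comm _ _)
    _ = K₂ * (∫⁻ x, meanSq g 0 x ^ 2 ∂m +
        ∫⁻ x, ∑' k : ℕ, (2 : ℝ≥0∞) ^ (k * (2 * s - 1)) * osc g k x ^ 2 ∂m) := by
        rw [lintegral_const_mul' _ _ ENNReal.coe_ne_top,
          lintegral_add_left (measurable_meanSq_sq hg 0)]
    _ ≤ K₂ * (K₄ * (∫⁻ x, ‖g x‖ₑ ^ 2) + K₃ * energy s g) :=
        mul_le_mul' le_rfl (add_le_add (hK₄ g hg) (hK₃ g hg))
    _ ≤ _ := by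
        rw [ENNReal.coe_mul, mul_assoc, ENNReal.coe_add, mul_add (K₃ + K₄ : ℝ≥0∞)]
        refine mul_le_mul' le_rfl (add_le_add ?_ ?_)
        · exact mul_le_mul' le_add_self le_rfl
        · exact mul_le_mul' le_self_add le_rfl

/-- For `s > 1/2` the means are reached from their limit at scale zero, which has to vanish. -/
theorem exists_hardySum_le_of_half_lt {D : Set (EuclideanSpace ℝ (Fin d))}
    {m : Measure (EuclideanSpace ℝ (Fin d))} [IsFiniteMeasure m] {c : ℝ≥0} (hc : c ≠ 0)
    (hlow : ∀ p ∈ D, ∀ r : ℝ, 0 < r → r ≤ 1 →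
      c * ENNReal.ofReal r ^ ((d : ℝ) - 1) ≤ m (Metric.ball p r))
    (hup : UpperRegular m ((d : ℝ) - 1)) {s : ℝ} (hs : 1 / 2 < s) :
    ∃ K : ℝ≥0, ∀ g : EuclideanSpace ℝ (Fin d) → ℂ, Measurable g →
      (∀ᵐ x ∂m, Tendsto (fun k => meanSq g k x) atTop (𝓝 0)) →
      hardySum s D g ≤ K * energy s g := by
  obtain ⟨K₁, hK₁⟩ := exists_hardySum_le_lintegral_tsum_meanSq hc hlow s
  obtain ⟨b, hb⟩ := exists_meanSq_le_osc_add d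
  obtain ⟨K₂, hK₂⟩ := exists_tsum_sq_tail_le (τ := 2 * s - 1) (by linarith)
  obtain ⟨K₃, hK₃⟩ := exists_lintegral_tsum_osc_le hup (by linarith : 0 < s)
  refine ⟨K₁ * (b ^ 2 * K₂ * K₃), fun g hg hlim => (hK₁ g hg).trans ?_⟩
  rw [ENNReal.coe_mul, mul_assoc]
  refine mul_le_mul' le_rfl ?_
  calc _ ≤ ∫⁻ x, (b ^ 2 * K₂ : ℝ≥0) *
        ∑' k : ℕ, (2 : ℝ≥0∞) ^ (k * (2 * s - 1)) * osc g k x ^ 2 ∂m := by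
        refine lintegral_mono_ae ?_
        filter_upwards [hlim] with x hx
        have hfin : ∀ k n : ℕ, meanSq g k x ≤
            b * ∑ j ∈ Finset.range n, osc g (k + j) x + meanSq g (k + n) x := by
          intro k n
          induction n with
          | zero => simp
          | succ n ih =>
            refine ih.trans ?_
            rw [Finset.sum_range_succ, mul_add, add_assoc]
            exact add_le_add le_rfl (hb g hg (k + n) x).1
        have htail : ∀ k : ℕ, meanSq g k x ≤ b * ∑' j, osc g (k + j) x := by
          intro k
          have h1 : Tendsto (fun n => b * (∑' j, osc g (k + j) x) + meanSq g (k + n) x) atTop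
              (𝓝 (b * (∑' j, osc g (k + j) x) + 0)) := by
            refine tendsto_const_nhds.add ?_
            have := (tendsto_add_atTop_iff_nat (f := fun n => meanSq g n x) k).2 hx
            simpa only [add_comm] using this
          rw [add_zero] at h1
          refine ge_of_tendsto' h1 fun n => (hfin k n).trans ?_
          exact add_le_add (mul_le_mul' le_rfl (ENNReal.sum_le_tsum _)) le_rfl
        calc _ ≤ ∑' k : ℕ, (2 : ℝ≥0∞) ^ (k * (2 * s - 1)) * (b * ∑' j, osc g (k + j) x) ^ 2 :=
              ENNReal.tsum_le_tsum fun k => mul_le_mul' le_rfl (pow_le_pow_left' (htail k) 2)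
          _ = (b : ℝ≥0∞) ^ 2 *
              ∑' k : ℕ, (2 : ℝ≥0∞) ^ (k * (2 * s - 1)) * (∑' j, osc g (k + j) x) ^ 2 := by
              rw [← ENNReal.tsum_mul_left]
              refine tsum_congr fun k => ?_
              ring
          _ ≤ _ := by
              rw [ENNReal.coe_mul, mul_assoc, ENNReal.coe_pow]
              exact mul_le_mul' le_rfl (hK₂ fun k => osc g k x)
    _ ≤ _ := by
        rw [lintegral_const_mul' _ _ ENNReal.coe_ne_top, ENNReal.coe_mul (b ^ 2 * K₂), mul_assoc]
        exact mul_le_mul' le_rfl (hK₃ g hg)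

/-- For `s > 1/2` the oscillations of a function of finite energy tend to zero at almost every
point of `D`. -/
theorem ae_tendsto_osc {m : Measure (EuclideanSpace ℝ (Fin d))} [SFinite m]
    (hup : UpperRegular m ((d : ℝ) - 1)) {s : ℝ} (hs : 1 / 2 < s)
    {g : EuclideanSpace ℝ (Fin d) → ℂ} (hg : Measurable g) (hE : energy s g ≠ ∞) :
    ∀ᵐ x ∂m, Tendsto (fun k => osc g k x) atTop (𝓝 0) := by
  obtain ⟨K, hK⟩ := exists_lintegral_tsum_osc_le hup (by linarith : 0 < s)
  have h := ae_lt_top (Measurable.tsum fun k => (measurable_osc_sq hg k).const_mul _)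
    (ne_top_of_le_ne_top (ENNReal.mul_ne_top ENNReal.coe_ne_top hE) (hK g hg))
  filter_upwards [h] with x hx
  have h1 := ENNReal.tendsto_atTop_zero_of_tsum_ne_top hx.ne
  have h2 : Tendsto (fun k => osc g k x ^ 2) atTop (𝓝 0) := by
    refine tendsto_of_tendsto_of_tendsto_of_le_of_le tendsto_const_nhds h1 (fun _ => zero_le)
      fun k => ?_
    refine le_mul_of_one_le_left' ?_
    rw [← ENNReal.rpow_zero (x := 2)]
    exact two_rpow_le_two_rpow (mul_nonneg (Nat.cast_nonneg _) (by linarith))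
  have h3 := (ENNReal.continuous_rpow_const (y := 1 / 2)).tendsto 0 |>.comp h2
  rw [ENNReal.zero_rpow_of_pos (by norm_num)] at h3
  refine h3.congr fun k => ?_
  simp only [Function.comp]
  rw [← ENNReal.rpow_two, ← ENNReal.rpow_mul]
  norm_num

/-- If `g₀` has vanishing averages at almost all points of `D` and `g` agrees with `g₀` on a set `Ω`
that is thick near `D`, then also the quadratic means of `g` vanish in the limit. Thus the trace
on `D` only depends on the values on `Ω`. -/
theorem ae_tendsto_meanSq {m : Measure (EuclideanSpace ℝ (Fin d))} [SFinite m]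
    (hup : UpperRegular m ((d : ℝ) - 1)) {s : ℝ} (hs : 1 / 2 < s)
    {Ω D : Set (EuclideanSpace ℝ (Fin d))} (hmD : ∀ᵐ x ∂m, x ∈ D)
    {c : ℝ≥0} (hc : c ≠ 0)
    (hΩD : ∀ x ∈ D, ∀ r : ℝ, 0 < r → r ≤ 1 →
      c * ENNReal.ofReal r ^ d ≤ volume (Ω ∩ Metric.ball x r))
    {g g₀ : EuclideanSpace ℝ (Fin d) → ℂ} (hg : Measurable g) (hg₀ : Measurable g₀)
    (hE : energy s g ≠ ∞) (hE₀ : energy s g₀ ≠ ∞) (hL₀ : MemLp g₀ 2 volume)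
    (hgg : g =ᵐ[volume.restrict Ω] g₀)
    (hlim : ∀ᵐ x ∂m, Tendsto (fun r : ℝ => ⨍ y in Metric.ball x r, g₀ y ∂volume) (𝓝[>] 0) (𝓝 0)) :
    ∀ᵐ x ∂m, Tendsto (fun k => meanSq g k x) atTop (𝓝 0) := by
  filter_upwards [hmD, ae_tendsto_osc hup hs hg hE, ae_tendsto_osc hup hs hg₀ hE₀, hlim]
    with x hxD hosc hosc₀ hav
  set V := volume (Metric.ball (0 : EuclideanSpace ℝ (Fin d)) 1) with hV
  have hVT : V ≠ ∞ := measure_ball_lt_top.ne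
  have hrad1 : ∀ k, rad k ≤ 1 := fun k => pow_le_one₀ (by norm_num) (by norm_num)
  have hrad : Tendsto rad atTop (𝓝[>] 0) := by
    refine tendsto_nhdsWithin_iff.2 ⟨?_, Eventually.of_forall rad_pos⟩
    exact (tendsto_add_atTop_iff_nat (f := fun n => (1 / 2 : ℝ) ^ n) 1).2
      (tendsto_pow_atTop_nhds_zero_of_lt_one (by norm_num) (by norm_num))
  -- the quadratic means of `g₀` are at most `|average| + oscillation`
  have h₀ : Tendsto (fun k => meanSq g₀ k x) atTop (𝓝 0) := by
    have h1 : Tendsto (fun k => ‖⨍ y in Metric.ball x (rad k), g₀ y ∂volume‖ₑ + osc g₀ k x) atTop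
        (𝓝 (0 + 0)) := by
      refine Tendsto.add ?_ hosc₀
      have := (continuous_enorm.tendsto (0 : ℂ)).comp (hav.comp hrad)
      rwa [enorm_zero] at this
    rw [add_zero] at h1
    refine tendsto_of_tendsto_of_tendsto_of_le_of_le tendsto_const_nhds h1 (fun _ => zero_le)
      fun k => ?_
    have hmem : MemLp g₀ 2 (ballMeasure k x) := by
      refine (hL₀.restrict _).smul_measure ?_
      exact ENNReal.inv_ne_top.2 (Metric.measure_ball_pos _ _ (rad_pos k)).ne'
    rw [setAverage_eq']
    exact eLpNorm_le_enorm_integral_add_oscillation hg₀ hmem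
  set C : ℝ≥0 := V.toNNReal / c with hC
  have h1 : ∀ k, meanSq g k x ≤ ((C ^ (1 / 2 : ℝ) : ℝ≥0) : ℝ≥0∞) * osc g k x +
      ((C ^ (1 / 2 : ℝ) : ℝ≥0) : ℝ≥0∞) * meanSq g₀ k x := by
    intro k
    have hvol : volume (Metric.ball x (rad k)) ≤ C * volume (Ω ∩ Metric.ball x (rad k)) := by
      refine le_trans (le_of_eq ?_) (mul_le_mul' le_rfl (hΩD x hxD _ (rad_pos k) (hrad1 k)))
      rw [volume_ball_eq _ (rad_pos k), ← mul_assoc, ← ENNReal.coe_mul, hC, div_mul_cancel₀ _ hc,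
        ENNReal.coe_toNNReal hVT, mul_comm]
    have hA : volume (Ω ∩ Metric.ball x (rad k)) ≠ 0 := by
      intro h0
      rw [h0, mul_zero] at hvol
      exact (Metric.measure_ball_pos volume x (rad_pos k)).not_ge hvol
    have e1 := (eLpNorm_cond_le (μ := volume) inter_subset_right hvol hA
      measure_ball_lt_top.ne hg).1
    have e2 := (eLpNorm_cond_le (μ := volume) inter_subset_right hvol hA
      measure_ball_lt_top.ne hg₀).2.2
    have e3 : eLpNorm g 2 (ProbabilityTheory.cond volume (Ω ∩ Metric.ball x (rad k))) =
        eLpNorm g₀ 2 (ProbabilityTheory.cond volume (Ω ∩ Metric.ball x (rad k))) := by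
      refine eLpNorm_congr_ae (Measure.ae_smul_measure ?_ _)
      exact ae_mono (Measure.restrict_mono inter_subset_left le_rfl) hgg
    rw [e3] at e1
    exact e1.trans (add_le_add le_rfl e2)
  have h2 : Tendsto (fun k => ((C ^ (1 / 2 : ℝ) : ℝ≥0) : ℝ≥0∞) * osc g k x +
      ((C ^ (1 / 2 : ℝ) : ℝ≥0) : ℝ≥0∞) * meanSq g₀ k x) atTop
      (𝓝 (((C ^ (1 / 2 : ℝ) : ℝ≥0) : ℝ≥0∞) * 0 + ((C ^ (1 / 2 : ℝ) : ℝ≥0) : ℝ≥0∞) * 0)) :=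
    (ENNReal.Tendsto.const_mul hosc (Or.inr ENNReal.coe_ne_top)).add
      (ENNReal.Tendsto.const_mul h₀ (Or.inr ENNReal.coe_ne_top))
  rw [mul_zero, add_zero] at h2
  exact tendsto_of_tendsto_of_tendsto_of_le_of_le tendsto_const_nhds h2 (fun _ => zero_le) h1

/-! ### The norm on the cylinder -/

theorem UpperRegular.isLocallyFiniteMeasure {X : Type*} [PseudoMetricSpace X] [MeasurableSpace X]
    {μ : Measure X} {l : ℝ} (hl : 0 ≤ l) (h : UpperRegular μ l) : IsLocallyFiniteMeasure μ := by
  obtain ⟨C, hC⟩ := h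
  refine ⟨fun x => ⟨Metric.ball x 1, Metric.ball_mem_nhds x one_pos, (hC x 1 one_pos).trans_lt ?_⟩⟩
  exact ENNReal.mul_lt_top ENNReal.coe_lt_top
    (ENNReal.rpow_lt_top_of_nonneg hl ENNReal.ofReal_ne_top)

/-- Dyadic decomposition of the kernel: the scale `2 ^ (-(k+2))` with `2 ^ (-(k+3)) ≤ t` contributes a
multiple of `t ^ (-a)`; the first summand takes care of `t ≥ 1/4`. -/
theorem inv_rpow_le_tsum {a : ℝ} (ha : 0 < a) {t : ℝ≥0∞} (ht : t ≠ 0) :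
    (t ^ a)⁻¹ ≤ 2 ^ (2 * a) + ∑' k : ℕ, (if t < ENNReal.ofReal (rad (k + 1)) then
      (2 : ℝ≥0∞) ^ (((k : ℝ) + 3) * a) else 0) := by
  have hbound : ∀ n : ℝ, (2 : ℝ≥0∞) ^ (-n) ≤ t → (t ^ a)⁻¹ ≤ 2 ^ (n * a) := by
    intro n hn
    rw [ENNReal.inv_le_iff_inv_le, ← ENNReal.rpow_neg]
    refine le_trans (le_of_eq ?_) (ENNReal.rpow_le_rpow hn ha.le)
    rw [← ENNReal.rpow_mul]; ring_nf
  have hex : ∃ n : ℕ, (2 : ℝ≥0∞) ^ (-(n : ℝ)) ≤ t := by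
    obtain ⟨n, hn⟩ := ENNReal.exists_inv_two_pow_lt ht
    refine ⟨n, le_trans (le_of_eq ?_) hn.le⟩
    rw [ENNReal.rpow_neg, ENNReal.rpow_natCast, ENNReal.inv_pow]
  classical
  obtain ⟨n, hn⟩ : ∃ n, n = Nat.find hex := ⟨_, rfl⟩
  have hspec := Nat.find_spec hex
  rw [← hn] at hspec
  by_cases h2 : n ≤ 2
  · refine le_add_right (hbound 2 (le_trans (two_rpow_le_two_rpow ?_) hspec))
    have : (n : ℝ) ≤ 2 := by exact_mod_cast h2
    linarith
  · obtain ⟨k, rfl⟩ : ∃ k, n = k + 3 := ⟨n - 3, by omega⟩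
    refine le_add_left (le_trans ?_ (ENNReal.le_tsum k))
    have hmin := Nat.find_min hex (m := k + 2) (by omega)
    rw [not_le] at hmin
    rw [if_pos]
    · have := hbound _ hspec
      push_cast at this
      exact this
    · rw [ofReal_rad]
      refine hmin.trans_eq ?_
      congr 1; push_cast; ring

/-- The potential of the measure on the wall `ℝ × D`, evaluated on the slice, in terms of dyadic
tubes around `D`. -/
theorem exists_lintegral_wall_le {D : Set (EuclideanSpace ℝ (Fin d))} (hD : IsClosed D)
    (hup : UpperRegular ((Measure.hausdorffMeasure (d : ℝ)).restrict (space ⁻¹' D)) d)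
    {s : ℝ} (hs : 0 < s) :
    ∃ A : ℝ≥0, ∀ x : EuclideanSpace ℝ (Fin d), x ∉ D →
      ∫⁻ w in Metric.ball (consPoint 0 x) 1, (edist (consPoint 0 x) w ^ (d + 2 * s))⁻¹
        ∂((Measure.hausdorffMeasure (d : ℝ)).restrict (space ⁻¹' D)) ≤
      A * (1 + ∑' k : ℕ, (Metric.thickening (rad (k + 1)) D).indicator
        (fun _ => (2 : ℝ≥0∞) ^ (k * (2 * s))) x) := by
  obtain ⟨C, hC⟩ := hup
  have ha : 0 < (d : ℝ) + 2 * s := by positivity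
  set μ := (Measure.hausdorffMeasure (d : ℝ)).restrict (space ⁻¹' D) with hμ
  have hWm : MeasurableSet (space ⁻¹' D) := continuous_space.measurable hD.measurableSet
  set A₁ : ℝ≥0∞ := 2 ^ (2 * ((d : ℝ) + 2 * s)) * C with hA₁
  set A₂ : ℝ≥0∞ := 2 ^ ((d : ℝ) + 6 * s) * C with hA₂
  have hA₁T : A₁ ≠ ∞ := ENNReal.mul_ne_top (two_rpow_ne_top _) ENNReal.coe_ne_top
  have hA₂T : A₂ ≠ ∞ := ENNReal.mul_ne_top (two_rpow_ne_top _) ENNReal.coe_ne_top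
  refine ⟨A₁.toNNReal + A₂.toNNReal, fun x hx => ?_⟩
  set z := consPoint 0 x with hz
  have hball : ∀ k : ℕ, (2 : ℝ≥0∞) ^ (((k : ℝ) + 3) * (d + 2 * s)) *
      μ (Metric.ball z (rad (k + 1))) ≤
      A₂ * (Metric.thickening (rad (k + 1)) D).indicator
        (fun _ => (2 : ℝ≥0∞) ^ (k * (2 * s))) x := by
    intro k
    by_cases hxk : x ∈ Metric.thickening (rad (k + 1)) D
    · rw [indicator_of_mem hxk]
      refine (mul_le_mul' le_rfl (hC z _ (rad_pos _))).trans_eq ?_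
      rw [ofReal_rad, ← ENNReal.rpow_mul, hA₂]
      calc _ = (C : ℝ≥0∞) * (2 ^ (((k : ℝ) + 3) * (d + 2 * s)) *
            2 ^ (-(((k + 1 : ℕ) : ℝ) + 1) * d)) := by ring
        _ = C * (2 ^ ((d : ℝ) + 6 * s) * 2 ^ (k * (2 * s))) := by
            rw [← two_rpow_add, ← two_rpow_add]; push_cast; ring_nf
        _ = _ := by ring
    · have h0 : μ (Metric.ball z (rad (k + 1))) = 0 := by
        rw [hμ, Measure.restrict_apply Metric.isOpen_ball.measurableSet]
        refine (congrArg _ (eq_empty_of_forall_notMem fun w hw => hxk ?_)).trans measure_empty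
        refine Metric.mem_thickening_iff.2 ⟨space w, hw.2, ?_⟩
        have := (dist_space_le w z).trans_lt hw.1
        rwa [hz, space_consPoint, dist_comm] at this
      simp [h0]
  have hm : ∀ k : ℕ, MeasurableSet {w | edist z w < ENNReal.ofReal (rad (k + 1))} := fun k =>
    (isOpen_lt (continuous_const.edist continuous_id) continuous_const).measurableSet
  calc _ ≤ ∫⁻ w in Metric.ball z 1, (2 ^ (2 * ((d : ℝ) + 2 * s)) +
        ∑' k : ℕ, (if edist z w < ENNReal.ofReal (rad (k + 1)) then
          (2 : ℝ≥0∞) ^ (((k : ℝ) + 3) * (d + 2 * s)) else 0)) ∂μ := by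
        have hae : ∀ᵐ w ∂(μ.restrict (Metric.ball z 1)), w ∈ space ⁻¹' D :=
          ae_restrict_of_ae (ae_restrict_mem hWm)
        refine lintegral_mono_ae ?_
        filter_upwards [hae] with w hw
        refine inv_rpow_le_tsum ha fun h0 => hx ?_
        rw [edist_eq_zero] at h0
        rw [← h0, hz] at hw
        simpa using hw
    _ ≤ A₁ + ∫⁻ w, ∑' k : ℕ, (if edist z w < ENNReal.ofReal (rad (k + 1)) then
          (2 : ℝ≥0∞) ^ (((k : ℝ) + 3) * (d + 2 * s)) else 0) ∂μ := by
        rw [lintegral_add_left measurable_const]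
        refine add_le_add ?_ (setLIntegral_le_lintegral _ _)
        rw [setLIntegral_const, hA₁]
        refine mul_le_mul' le_rfl ((hC z 1 one_pos).trans_eq ?_)
        simp
    _ = A₁ + ∑' k : ℕ, (2 : ℝ≥0∞) ^ (((k : ℝ) + 3) * (d + 2 * s)) *
          μ (Metric.ball z (rad (k + 1))) := by
        rw [lintegral_tsum fun k =>
          (Measurable.ite (hm k) measurable_const measurable_const).aemeasurable]
        congr 1
        refine tsum_congr fun k => ?_
        have e : (fun w => if edist z w < ENNReal.ofReal (rad (k + 1)) then
            (2 : ℝ≥0∞) ^ (((k : ℝ) + 3) * (d + 2 * s)) else 0) =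
            (Metric.ball z (rad (k + 1))).indicator
              fun _ => (2 : ℝ≥0∞) ^ (((k : ℝ) + 3) * (d + 2 * s)) := by
          ext w
          have hiff : edist z w < ENNReal.ofReal (rad (k + 1)) ↔
              w ∈ Metric.ball z (rad (k + 1)) := by
            rw [Metric.mem_ball, dist_comm, edist_dist, ENNReal.ofReal_lt_ofReal_iff (rad_pos _)]
          by_cases hw : w ∈ Metric.ball z (rad (k + 1))
          · rw [if_pos (hiff.2 hw), indicator_of_mem hw]
          · rw [if_neg (mt hiff.1 hw), indicator_of_notMem hw]
        rw [e, lintegral_indicator_const Metric.isOpen_ball.measurableSet]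
    _ ≤ A₁ + A₂ * ∑' k : ℕ, (Metric.thickening (rad (k + 1)) D).indicator
        (fun _ => (2 : ℝ≥0∞) ^ (k * (2 * s))) x := by
        rw [← ENNReal.tsum_mul_left]
        exact add_le_add le_rfl (ENNReal.tsum_le_tsum hball)
    _ ≤ _ := by
        rw [ENNReal.coe_add, ENNReal.coe_toNNReal hA₁T, ENNReal.coe_toNNReal hA₂T, mul_add, mul_one]
        refine add_le_add le_self_add (mul_le_mul' le_add_self le_rfl)

theorem measurable_zeroExt {Ω : Set (EuclideanSpace ℝ (Fin d))} (hΩ : MeasurableSet Ω)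
    {g : EuclideanSpace ℝ (Fin d) → ℂ} (hg : Measurable g) : Measurable (zeroExt Ω g) := by
  classical
  exact Measurable.ite (measurableSet_slice hΩ) (hg.comp continuous_space.measurable)
    measurable_const

theorem zeroExt_consPoint {Ω : Set (EuclideanSpace ℝ (Fin d))}
    (g : EuclideanSpace ℝ (Fin d) → ℂ) {x : EuclideanSpace ℝ (Fin d)} (hx : x ∈ Ω) :
    zeroExt Ω g (consPoint 0 x) = g x := by
  simp [zeroExt, hx]

theorem measurableEmbedding_consPoint : MeasurableEmbedding (consPoint (d := d) 0) :=
  isometry_consPoint.isClosedEmbedding.measurableEmbedding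

theorem lintegral_slice {c : ℝ≥0}
    (hc : (Measure.hausdorffMeasure (d : ℝ) : Measure (EuclideanSpace ℝ (Fin d))) = c • volume)
    {Ω : Set (EuclideanSpace ℝ (Fin d))} (hΩ : MeasurableSet Ω)
    (F : EuclideanSpace ℝ (Fin (d + 1)) → ℝ≥0∞) :
    ∫⁻ z, F z ∂((Measure.hausdorffMeasure (d : ℝ)).restrict (slice Ω)) =
      c * ∫⁻ x in Ω, F (consPoint 0 x) := by
  rw [hausdorffMeasure_restrict_slice hc hΩ, lintegral_smul_measure,
    measurableEmbedding_consPoint.lintegral_map]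
  rfl

/-- Splitting a symmetric double integral over the sum of two measures when the kernel vanishes
on the second one. -/
theorem lintegral_lintegral_add_measure {α : Type*} [MeasurableSpace α] {μ ν : Measure α}
    [SFinite μ] [SFinite ν] {k : α → α → ℝ≥0∞} (hk : Measurable (Function.uncurry k))
    (hsymm : ∀ x y, k x y = k y x) (h0 : ∀ᵐ x ∂ν, ∀ᵐ y ∂ν, k x y = 0) :
    ∫⁻ x, ∫⁻ y, k x y ∂(μ + ν) ∂(μ + ν) =
      ∫⁻ x, ∫⁻ y, k x y ∂μ ∂μ + 2 * ∫⁻ x, ∫⁻ y, k x y ∂ν ∂μ := by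
  have e1 : ∫⁻ x, ∫⁻ y, k x y ∂μ ∂ν = ∫⁻ x, ∫⁻ y, k x y ∂ν ∂μ := by
    rw [lintegral_lintegral_swap hk.aemeasurable]
    simp_rw [hsymm]
  have e2 : ∫⁻ x, ∫⁻ y, k x y ∂ν ∂ν = 0 := by
    rw [lintegral_congr_ae (g := fun _ => 0), lintegral_zero]
    filter_upwards [h0] with x hx
    rw [lintegral_congr_ae hx, lintegral_zero]
  have hm : ∀ ρ : Measure α, SFinite ρ → Measurable fun x => ∫⁻ y, k x y ∂ρ := fun ρ _ =>
    hk.lintegral_prod_right'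
  simp_rw [lintegral_add_measure]
  rw [lintegral_add_left (hm μ inferInstance), lintegral_add_left (hm μ inferInstance), e1, e2]
  ring

theorem IsAdmissible.notMem_dirichlet {Ω D : Set (EuclideanSpace ℝ (Fin d))}
    (h : IsAdmissible Ω D) {x : EuclideanSpace ℝ (Fin d)} (hx : x ∈ Ω) : x ∉ D := fun hxD =>
  h.isOpen.inter_frontier_eq.subset ⟨hx, h.dirichlet_subset hxD⟩

theorem hausdorffMeasure_restrict_cylinder {Ω D : Set (EuclideanSpace ℝ (Fin d))}
    (h : IsAdmissible Ω D) :
    (Measure.hausdorffMeasure (d : ℝ)).restrict (cylinder Ω D) =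
      (Measure.hausdorffMeasure (d : ℝ)).restrict (slice Ω) +
        (Measure.hausdorffMeasure (d : ℝ)).restrict (space ⁻¹' D) :=
  Measure.restrict_union (disjoint_left.2 fun _ hz hzD => h.notMem_dirichlet hz.2 hzD)
    (continuous_space.measurable h.isClosed_dirichlet.measurableSet)

theorem zeroExt_of_space_mem {Ω D : Set (EuclideanSpace ℝ (Fin d))}
    (h : IsAdmissible Ω D) (g : EuclideanSpace ℝ (Fin d) → ℂ)
    {z : EuclideanSpace ℝ (Fin (d + 1))} (hz : space z ∈ D) : zeroExt Ω g z = 0 := by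
  rw [zeroExt, if_neg]
  exact fun hzΩ => h.notMem_dirichlet hzΩ.2 hz

/-- The double integral on the cylinder consists of the interaction of the slice with itself, which
is bounded by the energy of `g`, and the interaction of the slice with the wall, which is bounded by
the Hardy sum. -/
theorem exists_lintegral_cylinder_le {Ω D : Set (EuclideanSpace ℝ (Fin d))}
    (h : IsAdmissible Ω D) {s : ℝ} (hs : 0 < s) :
    ∃ B : ℝ≥0, ∀ g : EuclideanSpace ℝ (Fin d) → ℂ, Measurable g →
      ∫⁻ x, ∫⁻ y in Metric.ball x 1,
          ‖zeroExt Ω g x - zeroExt Ω g y‖ₑ ^ 2 / edist x y ^ (d + 2 * s)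
          ∂((Measure.hausdorffMeasure (d : ℝ)).restrict (cylinder Ω D))
          ∂((Measure.hausdorffMeasure (d : ℝ)).restrict (cylinder Ω D)) ≤
        B * ((∫⁻ x, ‖g x‖ₑ ^ 2) + energy s g + hardySum s D g) := by
  have hΩm := h.isOpen.measurableSet
  obtain ⟨c, -, hc⟩ := exists_hausdorffMeasure_eq_smul_volume d
  obtain ⟨A, hA⟩ := exists_lintegral_wall_le h.isClosed_dirichlet h.upperRegular_wall hs
  refine ⟨c * c + 2 * (c * A), fun g hg => ?_⟩
  have hF := measurable_zeroExt hΩm hg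
  set F := zeroExt Ω g with hFdef
  have := h.upperRegular_wall.isLocallyFiniteMeasure (Nat.cast_nonneg d)
  have := (upperRegular_slice hΩm).isLocallyFiniteMeasure (Nat.cast_nonneg d)
  rw [hausdorffMeasure_restrict_cylinder h]
  set μ := (Measure.hausdorffMeasure (d : ℝ)).restrict (slice Ω) with hμ
  set ν := (Measure.hausdorffMeasure (d : ℝ)).restrict
    (space ⁻¹' D : Set (EuclideanSpace ℝ (Fin (d + 1)))) with hν
  have hνF : ∀ᵐ z ∂ν, F z = 0 := by
    refine ae_restrict_of_forall_mem (continuous_space.measurable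
      h.isClosed_dirichlet.measurableSet) fun z hz => zeroExt_of_space_mem h g hz
  set k : EuclideanSpace ℝ (Fin (d + 1)) → EuclideanSpace ℝ (Fin (d + 1)) → ℝ≥0∞ := fun x y =>
    (Metric.ball x 1).indicator (fun y => ‖F x - F y‖ₑ ^ 2 / edist x y ^ (d + 2 * s)) y with hk
  have hkm : Measurable (Function.uncurry k) := by
    have e : Function.uncurry k = {p : EuclideanSpace ℝ (Fin (d + 1)) ×
        EuclideanSpace ℝ (Fin (d + 1)) | dist p.2 p.1 < 1}.indicator
          fun p => ‖F p.1 - F p.2‖ₑ ^ 2 / edist p.1 p.2 ^ (d + 2 * s) := by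
      ext p; rfl
    rw [e]
    refine Measurable.indicator ?_
      (isOpen_lt (continuous_snd.dist continuous_fst) continuous_const).measurableSet
    refine Measurable.div (by fun_prop) (Measurable.pow_const ?_ _)
    exact (continuous_fst.edist continuous_snd).measurable
  have hksymm : ∀ x y, k x y = k y x := fun x y => by
    simp only [hk, indicator, Metric.mem_ball, dist_comm x y, edist_comm x y]
    rw [← enorm_neg (F x - F y), neg_sub]
  have hk0 : ∀ᵐ x ∂ν, ∀ᵐ y ∂ν, k x y = 0 := by
    filter_upwards [hνF] with x hx
    filter_upwards [hνF] with y hy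
    simp [hk, hx, hy, indicator]
  have e1 : ∫⁻ x, ∫⁻ y in Metric.ball x 1, ‖F x - F y‖ₑ ^ 2 / edist x y ^ (d + 2 * s)
      ∂(μ + ν) ∂(μ + ν) = ∫⁻ x, ∫⁻ y, k x y ∂(μ + ν) ∂(μ + ν) :=
    lintegral_congr fun x => (lintegral_indicator Metric.isOpen_ball.measurableSet _).symm
  rw [e1, lintegral_lintegral_add_measure hkm hksymm hk0]
  have hslice : ∫⁻ x, ∫⁻ y, k x y ∂μ ∂μ ≤ (c * c : ℝ≥0) * energy s g := by
    calc _ = c * ∫⁻ x in Ω, c * ∫⁻ y in Ω, k (consPoint 0 x) (consPoint 0 y) := by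
          rw [lintegral_slice hc hΩm]
          simp_rw [hμ, lintegral_slice hc hΩm]
      _ ≤ c * ∫⁻ x in Ω, c * ∫⁻ y in Metric.ball x 1,
            ‖g x - g y‖ₑ ^ 2 / edist x y ^ (d + 2 * s) := by
          refine mul_le_mul' le_rfl (setLIntegral_mono' hΩm fun x hx => mul_le_mul' le_rfl ?_)
          rw [← lintegral_indicator Metric.isOpen_ball.measurableSet]
          refine (setLIntegral_mono' hΩm fun y hy => le_of_eq ?_).trans
            (setLIntegral_le_lintegral Ω _)
          have e := isometry_consPoint.dist_eq (x := y) (y := x)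
          have e' := isometry_consPoint.edist_eq x y
          simp only [hk, indicator, Metric.mem_ball, e, e', hFdef, zeroExt_consPoint g hx,
            zeroExt_consPoint g hy]
      _ ≤ _ := by
          rw [lintegral_const_mul' _ _ ENNReal.coe_ne_top, ← mul_assoc, ← ENNReal.coe_mul]
          exact mul_le_mul' le_rfl (setLIntegral_le_lintegral _ _)
  have hwall : ∫⁻ x, ∫⁻ y, k x y ∂ν ∂μ ≤
      (c * A : ℝ≥0) * ((∫⁻ x, ‖g x‖ₑ ^ 2) + hardySum s D g) := by
    calc _ = c * ∫⁻ x in Ω, ∫⁻ y, k (consPoint 0 x) y ∂ν := lintegral_slice hc hΩm _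
      _ ≤ c * ∫⁻ x in Ω, ‖g x‖ₑ ^ 2 * (A * (1 + ∑' k : ℕ,
            (Metric.thickening (rad (k + 1)) D).indicator
              (fun _ => (2 : ℝ≥0∞) ^ (k * (2 * s))) x)) := by
          refine mul_le_mul' le_rfl (setLIntegral_mono' hΩm fun x hx => ?_)
          have e : ∫⁻ y, k (consPoint 0 x) y ∂ν = ‖g x‖ₑ ^ 2 *
              ∫⁻ w in Metric.ball (consPoint 0 x) 1,
                (edist (consPoint 0 x) w ^ (d + 2 * s))⁻¹ ∂ν := by
            rw [← lintegral_const_mul' _ _ (by simp),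
              ← lintegral_indicator Metric.isOpen_ball.measurableSet]
            refine lintegral_congr_ae ?_
            filter_upwards [hνF] with w hw
            rw [hFdef] at hw
            simp only [hk, indicator, hFdef, hw, sub_zero, zeroExt_consPoint g hx, div_eq_mul_inv]
          rw [e]
          exact mul_le_mul' le_rfl (hA x (h.notMem_dirichlet hx))
      _ ≤ c * ∫⁻ x, ‖g x‖ₑ ^ 2 * (A * (1 + ∑' k : ℕ,
            (Metric.thickening (rad (k + 1)) D).indicator
              (fun _ => (2 : ℝ≥0∞) ^ (k * (2 * s))) x)) :=
          mul_le_mul' le_rfl (setLIntegral_le_lintegral _ _)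
      _ = c * ∫⁻ x, A * (‖g x‖ₑ ^ 2 + ∑' k : ℕ, (2 : ℝ≥0∞) ^ (k * (2 * s)) *
            (Metric.thickening (rad (k + 1)) D).indicator (fun x => ‖g x‖ₑ ^ 2) x) := by
          congr 1
          refine lintegral_congr fun x => ?_
          have e : ∑' k : ℕ, (2 : ℝ≥0∞) ^ (k * (2 * s)) *
              (Metric.thickening (rad (k + 1)) D).indicator (fun x => ‖g x‖ₑ ^ 2) x =
              ‖g x‖ₑ ^ 2 * ∑' k : ℕ, (Metric.thickening (rad (k + 1)) D).indicator
              (fun _ => (2 : ℝ≥0∞) ^ (k * (2 * s))) x := by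
            rw [← ENNReal.tsum_mul_left]
            refine tsum_congr fun k => ?_
            by_cases hx : x ∈ Metric.thickening (rad (k + 1)) D
            · simp only [indicator_of_mem hx]; ring
            · simp only [indicator_of_notMem hx, mul_zero]
          rw [e]
          ring
      _ = _ := by
          rw [lintegral_const_mul' _ _ ENNReal.coe_ne_top, lintegral_add_left (by fun_prop),
            ENNReal.coe_mul, mul_assoc, lintegral_tsum, hardySum]
          · congr 4 with k
            rw [lintegral_const_mul' _ _ (two_rpow_ne_top _),
              lintegral_indicator Metric.isOpen_thickening.measurableSet]
          · intro k
            exact (Measurable.const_mul (Measurable.indicator (by fun_prop)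
              Metric.isOpen_thickening.measurableSet) _).aemeasurable
  refine (add_le_add hslice (mul_le_mul' le_rfl hwall)).trans ?_
  rw [ENNReal.coe_add, ENNReal.coe_mul 2, ENNReal.coe_ofNat, add_mul, mul_assoc 2]
  refine add_le_add (mul_le_mul' le_rfl ?_) (mul_le_mul' le_rfl (mul_le_mul' le_rfl ?_))
  · exact le_add_right le_add_self
  · exact add_le_add le_self_add le_rfl

theorem IsAdmissible.exists_fracNorm_zeroExt_le {Ω D : Set (EuclideanSpace ℝ (Fin d))}
    (h : IsAdmissible Ω D) {s : ℝ} (hs : 0 < s) (K : ℝ≥0) :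
    ∃ B : ℝ≥0, ∀ g : EuclideanSpace ℝ (Fin d) → ℂ, Measurable g →
      hardySum s D g ≤ K * ((∫⁻ x, ‖g x‖ₑ ^ 2) + energy s g) →
      lSetNorm (d : ℝ) s (cylinder Ω D) (zeroExt Ω g) ≤ B * hsNorm s g := by
  have hΩm := h.isOpen.measurableSet
  obtain ⟨c, -, hc⟩ := exists_hausdorffMeasure_eq_smul_volume d
  obtain ⟨B, hB⟩ := exists_lintegral_cylinder_le h hs
  have hsq : ∀ x : ℝ≥0∞, (x ^ 2) ^ (1 / 2 : ℝ) = x := fun x => by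
    rw [← ENNReal.rpow_two, ← ENNReal.rpow_mul]; norm_num
  refine ⟨c ^ (1 / 2 : ℝ) + (B * (1 + K)) ^ (1 / 2 : ℝ), fun g hg hgH => ?_⟩
  have hL2 : eLpNorm (zeroExt Ω g) 2 ((Measure.hausdorffMeasure (d : ℝ)).restrict (cylinder Ω D)) ≤
      (c ^ (1 / 2 : ℝ) : ℝ≥0) * eLpNorm g 2 volume := by
    refine le_of_sq_le_sq ?_
    rw [mul_pow, eLpNorm_two_sq, eLpNorm_two_sq, hausdorffMeasure_restrict_cylinder h,
      lintegral_add_measure, lintegral_slice hc hΩm]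
    have h0 : ∫⁻ z in space ⁻¹' D, ‖zeroExt Ω g z‖ₑ ^ 2 ∂(Measure.hausdorffMeasure (d : ℝ)) = 0 := by
      rw [setLIntegral_congr_fun (g := fun _ => 0)
        (continuous_space.measurable h.isClosed_dirichlet.measurableSet), lintegral_zero]
      intro z hz
      simp [zeroExt_of_space_mem h g hz]
    rw [h0, add_zero]
    refine mul_le_mul' (le_of_eq ?_) ?_
    · rw [← ENNReal.coe_pow, ← NNReal.rpow_two, ← NNReal.rpow_mul]
      norm_num
    · refine (setLIntegral_mono' hΩm fun x hx => le_of_eq ?_).trans (setLIntegral_le_lintegral Ω _)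
      rw [zeroExt_consPoint g hx]
  have hsemi : seminorm ((Measure.hausdorffMeasure (d : ℝ)).restrict (cylinder Ω D)) (d : ℝ) s
      (zeroExt Ω g) ≤ ((B * (1 + K)) ^ (1 / 2 : ℝ) : ℝ≥0) * hsNorm s g := by
    have h1 := (hB g hg).trans (mul_le_mul' le_rfl (add_le_add le_rfl hgH))
    calc _ ≤ ((B * (1 + K) : ℝ≥0) * ((∫⁻ x, ‖g x‖ₑ ^ 2) + energy s g)) ^ (1 / 2 : ℝ) := by
          refine ENNReal.rpow_le_rpow (h1.trans_eq ?_) (by norm_num)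
          push_cast; ring
      _ = ((B * (1 + K)) ^ (1 / 2 : ℝ) : ℝ≥0) *
          (eLpNorm g 2 volume ^ 2 + energy s g) ^ (1 / 2 : ℝ) := by
          rw [ENNReal.mul_rpow_of_nonneg _ _ (by norm_num),
            ENNReal.coe_rpow_of_nonneg _ (by norm_num), eLpNorm_two_sq]
      _ ≤ _ := by
          refine mul_le_mul' le_rfl ((ENNReal.rpow_add_le_add_rpow _ _ (by norm_num)
            (by norm_num)).trans_eq ?_)
          rw [hsq]
          rfl
  rw [ENNReal.coe_add, add_mul]
  exact add_le_add (hL2.trans (mul_le_mul' le_rfl le_self_add)) hsemi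

theorem IsAdmissible.exists_hardySum_le_of_lt_half {Ω D : Set (EuclideanSpace ℝ (Fin d))}
    (h : IsAdmissible Ω D) {s : ℝ} (hs0 : 0 < s) (hs : s < 1 / 2) :
    ∃ K : ℝ≥0, ∀ g : EuclideanSpace ℝ (Fin d) → ℂ, Measurable g →
      hardySum s D g ≤ K * ((∫⁻ x, ‖g x‖ₑ ^ 2) + energy s g) := by
  rcases h.dirichlet_set with rfl | hD
  · exact ⟨0, fun g _ => by simp [hardySum]⟩
  · have hd := h.dim_sub_one_nonneg
    obtain ⟨hfin, hup⟩ := hD.upperRegular hd h.isCompact_dirichlet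
    obtain ⟨c, hc, hlow⟩ := hD.exists_le_restrict
    exact MixedBoundary.exists_hardySum_le_of_lt_half hc hlow hup hs0 hs

theorem IsAdmissible.exists_hardySum_le_of_half_lt {Ω D : Set (EuclideanSpace ℝ (Fin d))}
    (h : IsAdmissible Ω D) {s : ℝ} (hs : 1 / 2 < s) :
    ∃ K : ℝ≥0, ∀ g g₀ : EuclideanSpace ℝ (Fin d) → ℂ, Measurable g → Measurable g₀ →
      MemHs s g → MemHsVanishing s D g₀ → g =ᵐ[volume.restrict Ω] g₀ →
      hardySum s D g ≤ K * ((∫⁻ x, ‖g x‖ₑ ^ 2) + energy s g) := by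
  have hE : ∀ g : EuclideanSpace ℝ (Fin d) → ℂ, MemHs s g → energy s g ≠ ∞ := by
    intro g hg htop
    have h1 : seminorm volume (d : ℝ) s g < ∞ := le_add_self.trans_lt hg.2
    have h2 : seminorm volume (d : ℝ) s g = energy s g ^ (1 / 2 : ℝ) := rfl
    rw [h2, htop, ENNReal.top_rpow_of_pos (by norm_num)] at h1
    exact lt_irrefl _ h1
  rcases h.dirichlet_set with rfl | hD
  · exact ⟨0, fun g _ _ _ _ _ _ => by simp [hardySum]⟩
  · have hd := h.dim_sub_one_nonneg
    obtain ⟨hfin, hup⟩ := hD.upperRegular hd h.isCompact_dirichlet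
    obtain ⟨c, hc, hlow⟩ := hD.exists_le_restrict
    obtain ⟨c', hc', hΩ⟩ := h.exists_le_volume
    obtain ⟨K, hK⟩ := MixedBoundary.exists_hardySum_le_of_half_lt hc hlow hup hs
    refine ⟨K, fun g g₀ hg hg₀ hgs hg₀s hgg => (hK g hg ?_).trans (mul_le_mul' le_rfl le_add_self)⟩
    exact ae_tendsto_meanSq hup hs (ae_restrict_mem h.isClosed_dirichlet.measurableSet) hc'
      (fun x hx => hΩ x (frontier_subset_closure (h.dirichlet_subset hx))) hg hg₀ (hE g hgs)
      (hE g₀ hg₀s.1) hg₀s.1.1 hgg hg₀s.2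

/-! ### Independence of representatives -/

theorem fracNorm_congr_ae {n : ℕ} {μ : Measure (EuclideanSpace ℝ (Fin n))} {l s : ℝ}
    {f f' : EuclideanSpace ℝ (Fin n) → ℂ} (h : f =ᵐ[μ] f') :
    fracNorm μ l s f = fracNorm μ l s f' := by
  rw [fracNorm, fracNorm, eLpNorm_congr_ae h, seminorm, seminorm]
  congr 2
  refine lintegral_congr_ae ?_
  filter_upwards [h] with x hx
  refine lintegral_congr_ae ?_
  filter_upwards [ae_restrict_of_ae h] with y hy
  rw [hx, hy]

theorem MemFrac.congr_ae {n : ℕ} {μ : Measure (EuclideanSpace ℝ (Fin n))} {l s : ℝ}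
    {f f' : EuclideanSpace ℝ (Fin n) → ℂ} (hf : MemFrac μ l s f) (h : f =ᵐ[μ] f') :
    MemFrac μ l s f' :=
  ⟨(memLp_congr_ae h).1 hf.1, (fracNorm_congr_ae h).symm.trans_lt hf.2⟩

theorem MemHsVanishing.congr_ae {s : ℝ} {D : Set (EuclideanSpace ℝ (Fin d))}
    {g g' : EuclideanSpace ℝ (Fin d) → ℂ} (hg : MemHsVanishing s D g) (h : g =ᵐ[volume] g') :
    MemHsVanishing s D g' := by
  refine ⟨MemFrac.congr_ae hg.1 h, ?_⟩
  filter_upwards [hg.2] with x hx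
  refine hx.congr fun r => average_congr (ae_restrict_of_ae h)

theorem IsAdmissible.zeroExt_congr_ae {Ω D : Set (EuclideanSpace ℝ (Fin d))}
    (h : IsAdmissible Ω D) {f g : EuclideanSpace ℝ (Fin d) → ℂ}
    (hfg : f =ᵐ[volume.restrict Ω] g) :
    zeroExt Ω f =ᵐ[(Measure.hausdorffMeasure (d : ℝ)).restrict (cylinder Ω D)] zeroExt Ω g := by
  obtain ⟨c, -, hc⟩ := exists_hausdorffMeasure_eq_smul_volume d
  have hΩm := h.isOpen.measurableSet
  rw [hausdorffMeasure_restrict_cylinder h, hausdorffMeasure_restrict_slice hc hΩm]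
  refine ae_add_measure_iff.2 ⟨Measure.ae_smul_measure ?_ _, ?_⟩
  · rw [measurableEmbedding_consPoint.ae_map_iff]
    filter_upwards [hfg, ae_restrict_mem hΩm] with x hx hxΩ
    rw [zeroExt_consPoint f hxΩ, zeroExt_consPoint g hxΩ, hx]
  · refine ae_restrict_of_forall_mem (continuous_space.measurable
      h.isClosed_dirichlet.measurableSet) fun z hz => ?_
    rw [zeroExt_of_space_mem h f hz, zeroExt_of_space_mem h g hz]

/-- A bound for all measurable extensions of `f` passes to the quotient norm. -/
theorem IsAdmissible.memLSet_and_le {Ω D : Set (EuclideanSpace ℝ (Fin d))}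
    (h : IsAdmissible Ω D) {s : ℝ} {B : ℝ≥0} {f : EuclideanSpace ℝ (Fin d) → ℂ}
    (hf : MemHsOn s Ω f)
    (hB : ∀ g, Measurable g → MemHs s g → g =ᵐ[volume.restrict Ω] f →
      lSetNorm (d : ℝ) s (cylinder Ω D) (zeroExt Ω g) ≤ B * hsNorm s g) :
    MemLSet (d : ℝ) s (cylinder Ω D) (zeroExt Ω f) ∧
      lSetNorm (d : ℝ) s (cylinder Ω D) (zeroExt Ω f) ≤ (B + 1 : ℝ≥0) * hsNormOn s Ω f := by
  have hrep : ∀ g, MemHs s g → g =ᵐ[volume.restrict Ω] f →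
      AEStronglyMeasurable (zeroExt Ω f)
        ((Measure.hausdorffMeasure (d : ℝ)).restrict (cylinder Ω D)) ∧
      lSetNorm (d : ℝ) s (cylinder Ω D) (zeroExt Ω f) ≤ B * hsNorm s g := by
    intro g hg hgf
    obtain ⟨g', hg'm, hgg'⟩ := hg.1.aestronglyMeasurable.aemeasurable
    have hg'g : g' =ᵐ[volume.restrict Ω] g := ae_restrict_of_ae hgg'.symm
    have hg'f : g' =ᵐ[volume.restrict Ω] f := hg'g.trans hgf
    have hz := h.zeroExt_congr_ae hg'f
    refine ⟨(measurable_zeroExt h.isOpen.measurableSet hg'm).aestronglyMeasurable.congr hz, ?_⟩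
    have e1 : lSetNorm (d : ℝ) s (cylinder Ω D) (zeroExt Ω f) =
        lSetNorm (d : ℝ) s (cylinder Ω D) (zeroExt Ω g') := (fracNorm_congr_ae hz).symm
    have e2 : hsNorm s g = hsNorm s g' := fracNorm_congr_ae hgg'
    rw [e1, e2]
    exact hB g' hg'm (MemFrac.congr_ae hg hgg') hg'f
  obtain ⟨g₀, hg₀, hg₀f⟩ := hf
  obtain ⟨hmeas, hle⟩ := hrep g₀ hg₀ hg₀f
  have hfin : lSetNorm (d : ℝ) s (cylinder Ω D) (zeroExt Ω f) < ∞ :=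
    hle.trans_lt (ENNReal.mul_lt_top ENNReal.coe_lt_top hg₀.2)
  refine ⟨⟨⟨hmeas, le_self_add.trans_lt hfin⟩, hfin⟩, ?_⟩
  have hB0 : ((B + 1 : ℝ≥0) : ℝ≥0∞) ≠ 0 := by simp
  rw [mul_comm, ← ENNReal.div_le_iff hB0 ENNReal.coe_ne_top]
  refine le_iInf₂ fun g hg => ?_
  rw [ENNReal.div_le_iff hB0 ENNReal.coe_ne_top, mul_comm]
  exact (hrep g hg.1 hg.2).2.trans (mul_le_mul' (by simp) le_rfl)

end MixedBoundary

theorem mainTheorem9 {d : ℕ} (Ω D : Set (EuclideanSpace ℝ (Fin d)))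
    (hΩD : MixedBoundary.IsAdmissible Ω D) :
    MixedBoundary.IsLSet (d : ℝ) (MixedBoundary.cylinder Ω D) ∧
    (∀ s : ℝ, 1 / 2 < s → s < 1 →
      ∃ C : ℝ≥0, ∀ f : EuclideanSpace ℝ (Fin d) → ℂ,
        MixedBoundary.MemHsVanishingOn s Ω D f →
          MixedBoundary.MemLSet (d : ℝ) s (MixedBoundary.cylinder Ω D)
            (MixedBoundary.zeroExt Ω f) ∧
          MixedBoundary.lSetNorm (d : ℝ) s (MixedBoundary.cylinder Ω D)
            (MixedBoundary.zeroExt Ω f) ≤ C * MixedBoundary.hsNormOn s Ω f) ∧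
    (∀ s : ℝ, 0 < s → s < 1 / 2 →
      ∃ C : ℝ≥0, ∀ f : EuclideanSpace ℝ (Fin d) → ℂ,
        MixedBoundary.MemHsOn s Ω f →
          MixedBoundary.MemLSet (d : ℝ) s (MixedBoundary.cylinder Ω D)
            (MixedBoundary.zeroExt Ω f) ∧
          MixedBoundary.lSetNorm (d : ℝ) s (MixedBoundary.cylinder Ω D)
            (MixedBoundary.zeroExt Ω f) ≤ C * MixedBoundary.hsNormOn s Ω f) := by
  refine ⟨hΩD.isLSet_cylinder, fun s hs _ => ?_, fun s hs0 hs => ?_⟩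
  · obtain ⟨K, hK⟩ := hΩD.exists_hardySum_le_of_half_lt hs
    obtain ⟨B, hB⟩ := hΩD.exists_fracNorm_zeroExt_le (s := s) (by linarith) K
    refine ⟨B + 1, fun f hf => ?_⟩
    obtain ⟨g₀, hg₀, hg₀f⟩ := hf
    refine hΩD.memLSet_and_le ⟨g₀, hg₀.1, hg₀f⟩ fun g hgm hg hgf => hB g hgm ?_
    obtain ⟨g₁, hg₁m, hg₀₁⟩ := hg₀.1.1.aestronglyMeasurable.aemeasurable
    refine hK g g₁ hgm hg₁m hg (hg₀.congr_ae hg₀₁) ?_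
    exact hgf.trans (hg₀f.symm.trans (ae_restrict_of_ae hg₀₁))
  · obtain ⟨K, hK⟩ := hΩD.exists_hardySum_le_of_lt_half hs0 hs
    obtain ⟨B, hB⟩ := hΩD.exists_fracNorm_zeroExt_le hs0 K
    exact ⟨B + 1, fun f hf => hΩD.memLSet_and_le hf fun g hgm _ _ => hB g hgm (hK g hgm)⟩
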